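/- Conventions. Let $M_0$ be a (Hausdorff, second countable, finite dimensional) smooth manifold. A CR structure of CR dimension $n$ on $M_0$ is a smooth complex rank-$n$ subbundle $T^{1,0}M_0$ of the complexified tangent bundle $\mathbb{C}TM_0$ such that, with $T^{0,1}M_0=\overline{T^{1,0}M_0}$, one has $T^{1,0}M_0\cap T^{0,1}M_0=0$ and $[\Gamma(T^{1,0}M_0),\Gamma(T^{1,0}M_0)]\subseteq\Gamma(T^{1,0}M_0)$. Put $\mathbb{C}HM_0=T^{1,0}M_0\oplus T^{0,1}M_0$. The (vector valued) Levi form of $M_0$ at $p_0$ is the map $$\mathcal{L}^{1,0}_{p_0}:T^{1,0}_{p_0}M_0\times T^{1,0}_{p_0}M_0\to\mathbb{C}T_{p_0}M_0/\mathbb{C}H_{p_0}M_0,\qquad \mathcal{L}^{1,0}_{p_0}(z,w)=\tfrac{1}{2i}\,[\overline{Z},W]_{p_0}\ \bmod \mathbb{C}H_{p_0}M_0,$$ where $Z,W$ are smooth sections of $T^{1,0}M_0$ near $p_0$ with $Z_{p_0}=z$, $W_{p_0}=w$. Let $\mathbf{G}_0$ be a (second countable) real Lie group with Lie algebra $\mathfrak{g}_0$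 (the bracket being that of left invariant vector fields), and suppose that $M_0$ is a $\mathbf{G}_0$-homogeneous CR manifold: $\mathbf{G}_0$ acts smoothly and transitively on the CR manifold $M_0$, and the differential of each $a\in\mathbf{G}_0$ maps $T^{1,0}M_0$ onto itself. Fix $p_0\in M_0$, let $\pi:\mathbf{G}_0\to M_0$, $\pi(a)=a\cdot p_0$, let $\mathfrak{g}=\mathbb{C}\otimes_{\mathbb{R}}\mathfrak{g}_0$, with conjugation $Z\mapsto\bar Z$ with respect to $\mathfrak{g}_0$, let $d\pi_e:\mathfrak{g}\to\mathbb{C}T_{p_0}M_0$ be the complexified differential, and let $$\mathfrak{q}=\{Z\in\mathfrak{g}\mid d\pi_e(Z)\in T^{0,1}_{p_0}M_0\},$$ so that $(\mathfrak{g}_0,\mathfrak{q})$ is the CR algebra of $M_0$ at $p_0$. **Proposition.** The Levi form at $p_0$ is well defined (it does not depend on the choice of $Z$ and $W$). One has $d\pi_e(\bar{\mathfrak{q}})=T^{1,0}_{p_0}M_0$ and $d\pi_e(\mathfrak{q}+\bar{\mathfrak{q}})=\mathbb{C}H_{p_0}M_0$, and $d\pi_e$ induces a complex linear isomorphism $$\varpi:\mathfrak{g}/(\mathfrak{q}+\bar{\mathfrak{q}})\to\mathbb{C}T_{p_0}M_0/\mathbb{C}H_{p_0}M_0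 .$$ If $\mathrm{pr}:\mathfrak{g}\to\mathfrak{g}/(\mathfrak{q}+\bar{\mathfrak{q}})$ is the projection, then for all $Z_1,Z_2\in\mathfrak{q}$ $$\mathcal{L}^{1,0}_{p_0}\big(d\pi_e(\bar Z_1),d\pi_e(\bar Z_2)\big)=\tfrac{1}{2i}\,\varpi\big(\mathrm{pr}([Z_1,\bar Z_2])\big),$$ and $\mathcal{L}^{1,0}_{p_0}$ is the only map $T^{1,0}_{p_0}M_0\times T^{1,0}_{p_0}M_0\to\mathbb{C}T_{p_0}M_0/\mathbb{C}H_{p_0}M_0$ with this property. -/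

import Mathlib

open scoped Manifold ContDiff TensorProduct Topology

noncomputable section

namespace CRGeom

section Complexification

variable {V W : Type*} [AddCommGroup V] [Module ℝ V] [AddCommGroup W] [Module ℝ W]

/-- Complex conjugation `a ⊗ v ↦ conj a ⊗ v` of the complexification `ℂ ⊗ V` with respect to its
real form `V`, as a conjugate-linear map. -/
def conjC (V : Type*) [AddCommGroup V] [Module ℝ V] :
    (ℂ ⊗[ℝ] V) →ₛₗ[starRingEnd ℂ] (ℂ ⊗[ℝ] V) where
  toFun := LinearMap.rTensor V Complex.conjLIE.toLinearEquiv.toLinearMap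
  map_add' x y := map_add _ x y
  map_smul' c x := by
    induction x using TensorProduct.induction_on with
    | zero => simp
    | tmul a v => simp [TensorProduct.smul_tmul']
    | add x y hx hy => simp only [smul_add, map_add, hx, hy]

@[simp] theorem conjC_tmul (a : ℂ) (v : V) :
    conjC V (a ⊗ₜ[ℝ] v) = (starRingEnd ℂ a) ⊗ₜ[ℝ] v := by
  simp [conjC]

@[simp] theorem conjC_conjC (x : ℂ ⊗[ℝ] V) : conjC V (conjC V x) = x := by
  induction x using TensorProduct.induction_on with
  | zero => simp
  | tmul a v => simp
  | add x y hx hy => simp only [map_add, hx, hy]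

/-- Conjugation commutes with complexified real linear maps. -/
theorem baseChange_conjC (f : V →ₗ[ℝ] W) (x : ℂ ⊗[ℝ] V) :
    f.baseChange ℂ (conjC V x) = conjC W (f.baseChange ℂ x) := by
  induction x using TensorProduct.induction_on with
  | zero => simp
  | tmul a v => simp
  | add x y hx hy => simp only [map_add, hx, hy]

/-- The real part `a ⊗ v ↦ (Re a) v` of an element of `ℂ ⊗ V`. -/
def reC (V : Type*) [AddCommGroup V] [Module ℝ V] : (ℂ ⊗[ℝ] V) →ₗ[ℝ] V :=
  (TensorProduct.lid ℝ V).toLinearMap ∘ₗ LinearMap.rTensor V Complex.reLm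

/-- The imaginary part `a ⊗ v ↦ (Im a) v` of an element of `ℂ ⊗ V`. -/
def imC (V : Type*) [AddCommGroup V] [Module ℝ V] : (ℂ ⊗[ℝ] V) →ₗ[ℝ] V :=
  (TensorProduct.lid ℝ V).toLinearMap ∘ₗ LinearMap.rTensor V Complex.imLm

@[simp] theorem reC_tmul (a : ℂ) (v : V) : reC V (a ⊗ₜ[ℝ] v) = a.re • v := by
  simp [reC]

@[simp] theorem imC_tmul (a : ℂ) (v : V) : imC V (a ⊗ₜ[ℝ] v) = a.im • v := by
  simp [imC]

theorem reC_smul (c : ℂ) (x : ℂ ⊗[ℝ] V) :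
    reC V (c • x) = c.re • reC V x - c.im • imC V x := by
  induction x using TensorProduct.induction_on with
  | zero => simp
  | tmul a v => simp [TensorProduct.smul_tmul', sub_smul, mul_smul]
  | add x y hx hy => simp only [smul_add, map_add, hx, hy]; abel

theorem imC_smul (c : ℂ) (x : ℂ ⊗[ℝ] V) :
    imC V (c • x) = c.re • imC V x + c.im • reC V x := by
  induction x using TensorProduct.induction_on with
  | zero => simp
  | tmul a v => simp [TensorProduct.smul_tmul', add_smul, mul_smul]
  | add x y hx hy => simp only [smul_add, map_add, hx, hy]; abel

end Complexification

section Manifold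

variable {E : Type*} [NormedAddCommGroup E] [NormedSpace ℝ E]
  {M : Type*} [TopologicalSpace M] [ChartedSpace E M]

/-- A finite dimensional real normed space is complete. -/
instance (priority := low) completeSpace_of_finiteDimensional [FiniteDimensional ℝ E] :
    CompleteSpace E := FiniteDimensional.complete ℝ E

/-- A smooth Lie group is a Lie group in the regularity class in which the Lie algebra of a Lie
group is defined. -/
instance lieGroup_minSmoothness {G : Type*} [TopologicalSpace G] [ChartedSpace E G] [Group G]
    [LieGroup 𝓘(ℝ, E) ∞ G] : LieGroup 𝓘(ℝ, E) (minSmoothness ℝ 3) G := by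
  rw [minSmoothness_of_isRCLikeNormedField]
  infer_instance

/-- The complexified tangent space `ℂ ⊗ T_x M`. -/
abbrev CT (E : Type*) [NormedAddCommGroup E] [NormedSpace ℝ E]
    {M : Type*} [TopologicalSpace M] [ChartedSpace E M] (x : M) : Type _ :=
  ℂ ⊗[ℝ] (TangentSpace 𝓘(ℝ, E) x)

variable [IsManifold 𝓘(ℝ, E) ∞ M]

/-- A complex vector field is smooth on `U` if its real and imaginary parts are. -/
def SmoothFieldOn (U : Set M) (Z : ∀ x : M, CT E x) : Prop :=
  ContMDiffOn 𝓘(ℝ, E) 𝓘(ℝ, E).tangent ∞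
    (fun x => (⟨x, reC _ (Z x)⟩ : TangentBundle 𝓘(ℝ, E) M)) U ∧
  ContMDiffOn 𝓘(ℝ, E) 𝓘(ℝ, E).tangent ∞
    (fun x => (⟨x, imC _ (Z x)⟩ : TangentBundle 𝓘(ℝ, E) M)) U

/-- The complex bilinear extension to complex vector fields of the Lie bracket of vector fields:
`[X + iY, X' + iY'] = [X, X'] - [Y, Y'] + i ([X, Y'] + [Y, X'])`. -/
def cBracket (Z W : ∀ x : M, CT E x) (x : M) : CT E x :=
  (1 : ℂ) ⊗ₜ[ℝ]
      (VectorField.mlieBracket 𝓘(ℝ, E) (fun y => reC _ (Z y)) (fun y => reC _ (W y)) x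
        - VectorField.mlieBracket 𝓘(ℝ, E) (fun y => imC _ (Z y)) (fun y => imC _ (W y)) x)
    + Complex.I ⊗ₜ[ℝ]
      (VectorField.mlieBracket 𝓘(ℝ, E) (fun y => reC _ (Z y)) (fun y => imC _ (W y)) x
        + VectorField.mlieBracket 𝓘(ℝ, E) (fun y => imC _ (Z y)) (fun y => reC _ (W y)) x)

variable (E M) in
/-- A CR structure of CR dimension `n` on the smooth manifold `M`, given by its bundle `T^{1,0}M`:
a smooth complex subbundle of rank `n` of the complexified tangent bundle (i.e. locally spanned by
`n` smooth sections) which meets its conjugate in zero and is formally integrable. -/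
structure CRStructure (n : ℕ) where
  /-- the fibre of `T^{1,0}M` at a point -/
  T10 : ∀ x : M, Submodule ℂ (CT E x)
  finrank_T10 : ∀ x, Module.finrank ℂ (T10 x) = n
  exists_frame : ∀ x : M, ∃ U : Set M, IsOpen U ∧ x ∈ U ∧
    ∃ L : Fin n → ∀ y : M, CT E y, (∀ j, SmoothFieldOn U (L j)) ∧
      ∀ y ∈ U, T10 y = Submodule.span ℂ (Set.range fun j => L j y)
  disjoint_conj : ∀ x, Disjoint (T10 x) ((T10 x).map (conjC _))
  integrable : ∀ (U : Set M), IsOpen U → ∀ Z W : ∀ y : M, CT E y,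
    SmoothFieldOn U Z → (∀ y ∈ U, Z y ∈ T10 y) →
    SmoothFieldOn U W → (∀ y ∈ U, W y ∈ T10 y) →
    ∀ y ∈ U, cBracket Z W y ∈ T10 y

namespace CRStructure

variable {n : ℕ} (C : CRStructure E M n)

/-- The fibre of `T^{0,1}M`, the conjugate of `T^{1,0}M`. -/
def T01 (x : M) : Submodule ℂ (CT E x) := (C.T10 x).map (conjC _)

theorem mem_T01_iff {x : M} {Z : CT E x} : Z ∈ C.T01 x ↔ conjC _ Z ∈ C.T10 x := by
  refine ⟨?_, fun h => ⟨conjC _ Z, h, conjC_conjC Z⟩⟩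
  rintro ⟨W, hW, rfl⟩
  simpa using hW

/-- The complexification `ℂ H_x M = T^{1,0}_x M ⊕ T^{0,1}_x M` of the real bundle `HM`. -/
def CH (x : M) : Submodule ℂ (CT E x) := C.T10 x ⊔ C.T01 x

/-- `Z` is a smooth section of `T^{1,0}M` on a neighbourhood of `x`, with value `z` at `x`. -/
def IsExtension (x : M) (z : C.T10 x) (Z : ∀ y : M, CT E y) : Prop :=
  (∃ U : Set M, IsOpen U ∧ x ∈ U ∧ SmoothFieldOn U Z ∧ ∀ y ∈ U, Z y ∈ C.T10 y) ∧ Z x = z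

theorem smoothFieldOn_sum {U : Set M} {L : Fin n → ∀ y : M, CT E y}
    (hL : ∀ j, SmoothFieldOn U (L j)) (c : Fin n → ℂ) :
    SmoothFieldOn U (fun y => ∑ j, c j • L j y) := by
  have key : ∀ (a b : ℝ) (X Y : ∀ y : M, TangentSpace 𝓘(ℝ, E) y),
      ContMDiffOn 𝓘(ℝ, E) 𝓘(ℝ, E).tangent ∞
        (fun x => (⟨x, X x⟩ : TangentBundle 𝓘(ℝ, E) M)) U →
      ContMDiffOn 𝓘(ℝ, E) 𝓘(ℝ, E).tangent ∞
        (fun x => (⟨x, Y x⟩ : TangentBundle 𝓘(ℝ, E) M)) U →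
      ContMDiffOn 𝓘(ℝ, E) 𝓘(ℝ, E).tangent ∞
        (fun x => (⟨x, a • X x + b • Y x⟩ : TangentBundle 𝓘(ℝ, E) M)) U := by
    intro a b X Y hX hY
    exact (ContMDiffOn.add_section (s := a • X) (t := b • Y)
      (ContMDiffOn.const_smul_section hX) (ContMDiffOn.const_smul_section hY))
  constructor
  · simp only [map_sum, reC_smul, sub_eq_add_neg, ← neg_smul]
    exact ContMDiffOn.sum_section fun j _ => key _ _ _ _ (hL j).1 (hL j).2
  · simp only [map_sum, imC_smul]
    exact ContMDiffOn.sum_section fun j _ => key _ _ _ _ (hL j).2 (hL j).1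

theorem exists_isExtension (x : M) (z : C.T10 x) :
    ∃ Z, C.IsExtension x z Z := by
  obtain ⟨U, hU, hx, L, hL, hspan⟩ := C.exists_frame x
  have hz : (z : CT E x) ∈ Submodule.span ℂ (Set.range fun j => L j x) := hspan x hx ▸ z.2
  obtain ⟨c, hc⟩ := (Submodule.mem_span_range_iff_exists_fun ℂ).1 hz
  refine ⟨fun y => ∑ j, c j • L j y, ⟨U, hU, hx, smoothFieldOn_sum hL c, fun y hy => ?_⟩, hc⟩
  rw [hspan y hy]
  exact Submodule.sum_mem _ fun j _ =>
    Submodule.smul_mem _ _ (Submodule.subset_span (Set.mem_range_self j))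

/-- The value `(1 / 2i) π_x [conj Z, W]_x` in `ℂ T_x M / ℂ H_x M`. -/
def leviValue (x : M) (Z W : ∀ y : M, CT E y) : CT E x ⧸ C.CH x :=
  (1 / (2 * Complex.I)) • (C.CH x).mkQ (cBracket (fun y => conjC _ (Z y)) W x)

/-- The vector valued Levi form `T^{1,0}_x M × T^{1,0}_x M → ℂ T_x M / ℂ H_x M`,
`(z, w) ↦ (1 / 2i) π_x [conj Z, W]_x`, where `Z`, `W` are smooth sections of `T^{1,0}M` with
values `z`, `w` at `x`. -/
def leviForm (x : M) (z w : C.T10 x) : CT E x ⧸ C.CH x :=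
  C.leviValue x (C.exists_isExtension x z).choose (C.exists_isExtension x w).choose

end CRStructure

end Manifold

section Homogeneous

variable {F : Type*} [NormedAddCommGroup F] [NormedSpace ℝ F]
  {G : Type*} [TopologicalSpace G] [ChartedSpace F G] [Group G]
  {E : Type*} [NormedAddCommGroup E] [NormedSpace ℝ E]
  {M : Type*} [TopologicalSpace M] [ChartedSpace E M] [IsManifold 𝓘(ℝ, E) ∞ M]

/-- The complexification `𝔤 = ℂ ⊗ 𝔤₀` of the Lie algebra `𝔤₀` of the real Lie group `G`. -/
abbrev CLie (F : Type*) [NormedAddCommGroup F] [NormedSpace ℝ F]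
    (G : Type*) [TopologicalSpace G] [ChartedSpace F G] [Group G] : Type _ :=
  ℂ ⊗[ℝ] (GroupLieAlgebra 𝓘(ℝ, F) G)

/-- `M` with the CR structure `C` is a `G`-homogeneous CR manifold: the action of `G` on `M` is
smooth, transitive and by CR diffeomorphisms. -/
structure IsHomogeneousCR (F G : Type*) [NormedAddCommGroup F] [NormedSpace ℝ F]
    [TopologicalSpace G] [ChartedSpace F G] [Group G] [MulAction G M] {n : ℕ}
    (C : CRStructure E M n) : Prop where
  smooth : ContMDiff (𝓘(ℝ, F).prod 𝓘(ℝ, E)) 𝓘(ℝ, E) ∞ (fun p : G × M => p.1 • p.2)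
  transitive : ∀ x y : M, ∃ a : G, a • x = y
  map_T10 : ∀ (a : G) (x : M),
    (C.T10 x).map ((mfderiv 𝓘(ℝ, E) 𝓘(ℝ, E) (fun y : M => a • y) x).toLinearMap.baseChange ℂ)
      = C.T10 (a • x)

/-- The differential at the identity of the orbit map `a ↦ a • p`, with values in `T_p M`
(recall `1 • p = p`). -/
def orbitDeriv (F G : Type*) [NormedAddCommGroup F] [NormedSpace ℝ F]
    [TopologicalSpace G] [ChartedSpace F G] [Group G] [MulAction G M] (p : M) :
    GroupLieAlgebra 𝓘(ℝ, F) G →ₗ[ℝ] TangentSpace 𝓘(ℝ, E) p :=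
  (mfderiv 𝓘(ℝ, F) 𝓘(ℝ, E) (fun a : G => a • p) (1 : G)).toLinearMap

/-- The complexified differential `𝔤 → ℂ T_p M`. -/
def dpi (F G : Type*) [NormedAddCommGroup F] [NormedSpace ℝ F]
    [TopologicalSpace G] [ChartedSpace F G] [Group G] [MulAction G M] (p : M) :
    CLie F G →ₗ[ℂ] CT E p :=
  (orbitDeriv F G p).baseChange ℂ

namespace CRStructure

variable [MulAction G M] {n : ℕ} (C : CRStructure E M n)

/-- The subspace `𝔮 = {Z ∈ 𝔤 | dπ Z ∈ T^{0,1}_p M}` of the complexified Lie algebra; the pair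
`(𝔤₀, 𝔮)` is the CR algebra of `M` at `p`. -/
def q (F G : Type*) [NormedAddCommGroup F] [NormedSpace ℝ F]
    [TopologicalSpace G] [ChartedSpace F G] [Group G] [MulAction G M] (p : M) :
    Submodule ℂ (CLie F G) :=
  (C.T01 p).comap (dpi F G p)

/-- The conjugate of `𝔮` with respect to the real form `𝔤₀`. -/
def qbar (F G : Type*) [NormedAddCommGroup F] [NormedSpace ℝ F]
    [TopologicalSpace G] [ChartedSpace F G] [Group G] [MulAction G M] (p : M) :
    Submodule ℂ (CLie F G) :=
  (C.q F G p).map (conjC _)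

/-- The map `𝔮 → T^{1,0}_p M`, `Z ↦ dπ (conj Z)`. -/
def dpiConj (F G : Type*) [NormedAddCommGroup F] [NormedSpace ℝ F]
    [TopologicalSpace G] [ChartedSpace F G] [Group G] [MulAction G M] (p : M)
    (Z : C.q F G p) : C.T10 p :=
  ⟨dpi F G p (conjC _ (Z : CLie F G)), by
    have h : dpi F G p (Z : CLie F G) ∈ C.T01 p := Z.2
    rw [mem_T01_iff] at h
    exact (baseChange_conjC (orbitDeriv (E := E) F G p) (Z : CLie F G)) ▸ h⟩

end CRStructure

end Homogeneous

end CRGeom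

end

/-!
The orbit map `π : G → M`, `π a = a • p`, is equivariant, hence of constant rank. Being surjective
with second countable source, it is a submersion (`CRGeom.orbitDeriv_surjective`): a map of constant
rank `r` sends small open sets onto sets of Hausdorff dimension at most `r`, and countably many of
these cover an open piece of `M`. Hence `dπ : 𝔤 → ℂT_pM` is surjective. As `𝔮` and its conjugate are
the preimages of `T^{0,1}_pM` and `T^{1,0}_pM`, the statements about images and the isomorphism `ϖ`
are linear algebra.

For the Levi form, let `Z₁ ∈ 𝔮`, `Z₂ ∈ conj 𝔮`, and let `W₁`, `W₂` be any sections of `T^{0,1}M` and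
`T^{1,0}M` near `p` with values `dπ Z₁`, `dπ Z₂` at `p`. The left invariant fields `Z_i` need not be
`π`-related to the `W_i`, but the defects `e_i = dπ(Z_i) - W_i ∘ π`, which are vector fields
along `π`, vanish at the identity, and the difference `dπ [Z₁, Z₂] - [W₁, W₂]_p` is the derivative
of `e₂` in the direction `Z₁` minus the derivative of `e₁` in the direction `Z₂`
(`CRGeom.baseChange_cBracket_sub_cBracket`). The action is by CR maps, so `e₁` takes values in
`T^{0,1}M` and `e₂` in `T^{1,0}M`; the derivative of a section of a subbundle at one of its zeros
lies in the fibre of the subbundle, since the difference quotients do so in the limit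
(`CRGeom.CRStructure.derivAlong_mem_T10`). Therefore the difference lies in `ℂH_pM`
(`CRGeom.IsHomogeneousCR.dpi_lie_sub_cBracket_mem`). This holds for all extensions, so it proves the
formula for the Levi form and its independence of the extensions at the same time. Uniqueness
holds because `Z ↦ dπ (conj Z)` maps `𝔮` onto `T^{1,0}_pM`.
-/

/-! ### Images of maps of constant rank -/

open Filter in
/-- A map of constant rank `r` sends a neighbourhood of each point onto a set of Hausdorff
dimension at most `r`: in suitable coordinates of the source it depends on `r` variables only. -/
theorem ContDiffAt.exists_dimH_image_le_of_eventually_finrank_range_eq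
    {F E : Type*} [NormedAddCommGroup F] [NormedSpace ℝ F] [FiniteDimensional ℝ F]
    [NormedAddCommGroup E] [NormedSpace ℝ E] [FiniteDimensional ℝ E]
    {f : F → E} {x : F} {r : ℕ} (hf : ContDiffAt ℝ 1 f x)
    (hr : ∀ᶠ y in 𝓝 x, Module.finrank ℝ (fderiv ℝ f y).range = r) :
    ∃ U ∈ 𝓝 x, dimH (f '' U) ≤ r := by
  set A := fderiv ℝ f x with hA
  have := FiniteDimensional.complete ℝ F
  have hrA : Module.finrank ℝ A.range = r := hr.self_of_nhds
  obtain ⟨P₀, hP₀⟩ := A.range.subtype.exists_leftInverse_of_injective (Submodule.ker_subtype _)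
  obtain ⟨Q₀, hQ₀⟩ := A.ker.subtype.exists_leftInverse_of_injective (Submodule.ker_subtype _)
  let P : E →L[ℝ] A.range := P₀.toContinuousLinearMap
  let Q : F →L[ℝ] A.ker := Q₀.toContinuousLinearMap
  have hP : ∀ v : A.range, P v = v := fun v => LinearMap.congr_fun hP₀ v
  have hQ : ∀ v : A.ker, Q v = v := fun v => LinearMap.congr_fun hQ₀ v
  -- straightening coordinates of the source: the component of `f` along the range of its
  -- derivative at `x`, completed by a projection onto the kernel
  let Φ : F → A.range × A.ker := fun y => (P (f y), Q y)
  let Φ' : F →L[ℝ] A.range × A.ker := (P.comp A).prod Q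
  have hinj : Function.Injective Φ' := by
    refine (injective_iff_map_eq_zero Φ').2 fun v hv => ?_
    have h1 : P (A v) = 0 := congrArg Prod.fst hv
    have h2 : Q v = 0 := congrArg Prod.snd hv
    have h3 : A v = 0 := by
      have := hP ⟨A v, v, rfl⟩
      rw [h1] at this
      exact (congrArg Subtype.val this).symm
    have := hQ ⟨v, h3⟩
    rw [h2] at this
    exact (congrArg Subtype.val this).symm
  have hdim : Module.finrank ℝ F = Module.finrank ℝ (A.range × A.ker) := by
    rw [Module.finrank_prod]
    exact (LinearMap.finrank_range_add_finrank_ker A.toLinearMap).symm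
  let e : F ≃L[ℝ] A.range × A.ker :=
    (LinearEquiv.ofInjectiveOfFinrankEq Φ'.toLinearMap hinj hdim).toContinuousLinearEquiv
  have hΦ : ContDiffAt ℝ 1 Φ x :=
    (P.contDiff.contDiffAt.comp x hf).prodMk Q.contDiff.contDiffAt
  have hΦ' : HasFDerivAt Φ (e : F →L[ℝ] A.range × A.ker) x := by
    have h1 : HasFDerivAt f A x := (hf.differentiableAt one_ne_zero).hasFDerivAt
    exact (P.hasFDerivAt.comp x h1).prodMk Q.hasFDerivAt
  have hstrict : HasStrictFDerivAt Φ (e : F →L[ℝ] A.range × A.ker) x :=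
    hΦ.hasStrictFDerivAt' hΦ' one_ne_zero
  let Ψ : A.range × A.ker → F := hΦ.localInverse hΦ' one_ne_zero
  have hΨ : ContDiffAt ℝ 1 Ψ (Φ x) := hΦ.to_localInverse hΦ' one_ne_zero
  have hΨx : Ψ (Φ x) = x := hstrict.localInverse_apply_image
  have hΨΦ : ∀ᶠ y in 𝓝 x, Ψ (Φ y) = y := hstrict.eventually_left_inverse
  have hΦΨ : ∀ᶠ z in 𝓝 (Φ x), Φ (Ψ z) = z := hstrict.eventually_right_inverse
  have hΨc : Tendsto Ψ (𝓝 (Φ x)) (𝓝 x) := by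
    have := hΨ.continuousAt.tendsto
    rwa [hΨx] at this
  have hev : ∀ᶠ z in 𝓝 (Φ x), ContDiffAt ℝ 1 Ψ z ∧ ContDiffAt ℝ 1 f (Ψ z) ∧
      Module.finrank ℝ (fderiv ℝ f (Ψ z)).range = r ∧ Φ (Ψ z) = z :=
    (hΨ.eventually (by simp)).and <| (hΨc.eventually (hf.eventually (by simp))).and <|
      (hΨc.eventually hr).and hΦΨ
  obtain ⟨ε, hε, hball⟩ := Metric.eventually_nhds_iff_ball.1 hev
  rw [← Prod.mk.eta (p := Φ x), ← ball_prod_same] at hball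
  have hcd : ∀ z ∈ Metric.ball (Φ x).1 ε ×ˢ Metric.ball (Φ x).2 ε,
      ContDiffAt ℝ 1 (f ∘ Ψ) z := fun z hz =>
    (hball z hz).2.1.comp z (hball z hz).1
  -- the rank of `f` is that of its first component in the straightened coordinates, so that the
  -- second coordinate does not contribute
  have hzero : ∀ z ∈ Metric.ball (Φ x).1 ε ×ˢ Metric.ball (Φ x).2 ε, ∀ κ : A.ker,
      fderiv ℝ (f ∘ Ψ) z (0, κ) = 0 := by
    intro z hz κ
    obtain ⟨h1, h2, h3, h4⟩ := hball z hz
    have d1 := (h1.differentiableAt one_ne_zero).hasFDerivAt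
    have d2 := (h2.differentiableAt one_ne_zero).hasFDerivAt
    have d3 := d2.comp z d1
    have hloc : (fun w => P ((f ∘ Ψ) w)) =ᶠ[𝓝 z] Prod.fst := by
      filter_upwards [(Metric.isOpen_ball.prod Metric.isOpen_ball).mem_nhds hz] with w hw
      exact congrArg Prod.fst (hball w hw).2.2.2
    have hfst : P.comp ((fderiv ℝ f (Ψ z)).comp (fderiv ℝ Ψ z)) =
        ContinuousLinearMap.fst ℝ A.range A.ker :=
      (P.hasFDerivAt.comp z d3).unique (hasFDerivAt_fst.congr_of_eventuallyEq hloc)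
    have hfst' : ∀ w, P (fderiv ℝ f (Ψ z) (fderiv ℝ Ψ z w)) = w.1 := fun w =>
      DFunLike.congr_fun hfst w
    let P' : (fderiv ℝ f (Ψ z)).range →ₗ[ℝ] A.range := P.toLinearMap ∘ₗ Submodule.subtype _
    have hsurj : Function.Surjective P' := fun c =>
      ⟨⟨fderiv ℝ f (Ψ z) (fderiv ℝ Ψ z (c, 0)), _, rfl⟩, hfst' (c, 0)⟩
    have hinj' : Function.Injective P' :=
      (LinearMap.injective_iff_surjective_of_finrank_eq_finrank (h3.trans hrA.symm)).2 hsurj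
    rw [d3.fderiv]
    have : P' ⟨fderiv ℝ f (Ψ z) (fderiv ℝ Ψ z (0, κ)), _, rfl⟩ = P' 0 := by
      rw [map_zero]; exact hfst' (0, κ)
    exact congrArg Subtype.val (hinj' this)
  let g : A.range → E := fun c => f (Ψ (c, (Φ x).2))
  have hconst : ∀ c ∈ Metric.ball (Φ x).1 ε, ∀ k ∈ Metric.ball (Φ x).2 ε,
      f (Ψ (c, k)) = g c := by
    intro c hc k hk
    have hd : ∀ k ∈ Metric.ball (Φ x).2 ε,
        HasFDerivAt (fun k => f (Ψ (c, k))) (0 : A.ker →L[ℝ] E) k := by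
      intro k hk
      have h1 := ((hcd (c, k) ⟨hc, hk⟩).differentiableAt one_ne_zero).hasFDerivAt
      have h2 := h1.comp k (hasFDerivAt_prodMk_right c k)
      convert! h2 using 1
      ext κ
      exact (hzero (c, k) ⟨hc, hk⟩ κ).symm
    exact (convex_ball _ _).is_const_of_fderivWithin_eq_zero (𝕜 := ℝ)
      (f := fun k => f (Ψ (c, k)))
      (fun k hk => (hd k hk).differentiableAt.differentiableWithinAt)
      (fun k hk => by
        rw [fderivWithin_of_isOpen Metric.isOpen_ball hk, (hd k hk).fderiv])
      hk (Metric.mem_ball_self hε)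
  have hg : ContDiffOn ℝ 1 g (Metric.ball (Φ x).1 ε) := fun c hc =>
    ((hcd (c, (Φ x).2) ⟨hc, Metric.mem_ball_self hε⟩).comp c
      (contDiffAt_id.prodMk contDiffAt_const)).contDiffWithinAt
  have hU : ∀ᶠ y in 𝓝 x, Φ y ∈ Metric.ball (Φ x).1 ε ×ˢ Metric.ball (Φ x).2 ε :=
    hΦ.continuousAt.eventually ((Metric.isOpen_ball.prod Metric.isOpen_ball).mem_nhds
      ⟨Metric.mem_ball_self hε, Metric.mem_ball_self hε⟩)
  refine ⟨_, hΨΦ.and hU, ?_⟩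
  calc dimH (f '' {y | Ψ (Φ y) = y ∧ Φ y ∈ Metric.ball (Φ x).1 ε ×ˢ Metric.ball (Φ x).2 ε})
      ≤ dimH (g '' Metric.ball (Φ x).1 ε) := by
        refine dimH_mono ?_
        rintro _ ⟨y, ⟨hy, hy'⟩, rfl⟩
        refine ⟨(Φ y).1, hy'.1, ?_⟩
        rw [← hconst _ hy'.1 _ hy'.2, Prod.mk.eta, hy]
    _ ≤ dimH (Metric.ball (Φ x).1 ε) := hg.dimH_image_le (convex_ball _ _) subset_rfl
    _ ≤ dimH (Set.univ : Set A.range) := dimH_mono (Set.subset_univ _)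
    _ = r := by rw [Real.dimH_univ_eq_finrank, hrA]

theorem ContinuousLinearMap.IsInvertible.finrank_range_comp_comp
    {V₁ V₂ V₃ V₄ : Type*} [NormedAddCommGroup V₁] [NormedSpace ℝ V₁]
    [NormedAddCommGroup V₂] [NormedSpace ℝ V₂] [NormedAddCommGroup V₃] [NormedSpace ℝ V₃]
    [NormedAddCommGroup V₄] [NormedSpace ℝ V₄]
    {A : V₃ →L[ℝ] V₄} {C : V₁ →L[ℝ] V₂} (hA : A.IsInvertible) (hC : C.IsInvertible)
    (B : V₂ →L[ℝ] V₃) :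
    Module.finrank ℝ (A.comp (B.comp C)).range = Module.finrank ℝ B.range := by
  obtain ⟨a, rfl⟩ := hA
  obtain ⟨c, rfl⟩ := hC
  have : ((a : V₃ →L[ℝ] V₄).comp (B.comp (c : V₁ →L[ℝ] V₂))).range =
      B.range.map a.toLinearEquiv.toLinearMap := by
    ext v
    constructor
    · rintro ⟨x, rfl⟩; exact ⟨B (c x), ⟨c x, rfl⟩, rfl⟩
    · rintro ⟨_, ⟨x, rfl⟩, rfl⟩; exact ⟨c.symm x, by simp⟩
  rw [this]
  exact LinearEquiv.finrank_map_eq a.toLinearEquiv B.range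

open Filter in
/-- A surjective map of constant rank from a second countable manifold is a submersion. The
target is a countable union of images of small open sets, so that its dimension is at most the
rank. -/
theorem ContMDiff.finrank_le_of_surjective_of_finrank_range_mfderiv_eq
    {F : Type*} [NormedAddCommGroup F] [NormedSpace ℝ F] [FiniteDimensional ℝ F]
    {N : Type*} [TopologicalSpace N] [SecondCountableTopology N]
    [ChartedSpace F N] [IsManifold 𝓘(ℝ, F) 1 N]
    {E : Type*} [NormedAddCommGroup E] [NormedSpace ℝ E] [FiniteDimensional ℝ E]
    {M : Type*} [TopologicalSpace M] [ChartedSpace E M] [IsManifold 𝓘(ℝ, E) 1 M]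
    {f : N → M} {r : ℕ} (hf : ContMDiff 𝓘(ℝ, F) 𝓘(ℝ, E) 1 f) (hsurj : Function.Surjective f)
    (hr : ∀ a, Module.finrank ℝ (mfderiv 𝓘(ℝ, F) 𝓘(ℝ, E) f a).range = r) (p : M) :
    Module.finrank ℝ E ≤ r := by
  set φ := extChartAt 𝓘(ℝ, E) p
  have hS : IsOpen (f ⁻¹' φ.source) :=
    (isOpen_extChartAt_source (I := 𝓘(ℝ, E)) p).preimage hf.continuous
  have hloc : ∀ a ∈ f ⁻¹' φ.source, ∃ U ∈ 𝓝 a, dimH (φ '' (f '' U)) ≤ r := by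
    intro a ha
    set ψ := extChartAt 𝓘(ℝ, F) a
    let g : F → E := φ ∘ f ∘ ψ.symm
    have ht : ψ.target ∩ ψ.symm ⁻¹' (f ⁻¹' φ.source) ∈ 𝓝 (ψ a) :=
      inter_mem (extChartAt_target_mem_nhds a) <|
        (continuousAt_extChartAt_symm (I := 𝓘(ℝ, F)) a).preimage_mem_nhds <| by
          simpa [ψ] using hS.mem_nhds ha
    have hcomp : ∀ y ∈ ψ.target ∩ ψ.symm ⁻¹' (f ⁻¹' φ.source),
        ContMDiffAt 𝓘(ℝ, F) 𝓘(ℝ, E) 1 g y ∧ fderiv ℝ g y =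
          (mfderiv 𝓘(ℝ, E) 𝓘(ℝ, E) φ (f (ψ.symm y))).comp
            ((mfderiv 𝓘(ℝ, F) 𝓘(ℝ, E) f (ψ.symm y)).comp
              (mfderiv 𝓘(ℝ, F) 𝓘(ℝ, F) ψ.symm y)) := by
      rintro y ⟨hy, hy'⟩
      have h1 : ContMDiffAt 𝓘(ℝ, F) 𝓘(ℝ, F) 1 ψ.symm y :=
        (contMDiffOn_extChartAt_symm a).contMDiffAt
          ((isOpen_extChartAt_target (I := 𝓘(ℝ, F)) a).mem_nhds hy)
      have h2 : ContMDiffAt 𝓘(ℝ, E) 𝓘(ℝ, E) 1 φ (f (ψ.symm y)) :=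
        contMDiffAt_extChartAt' (by simpa [φ] using hy')
      have h3 := (hf (ψ.symm y)).comp y h1
      refine ⟨h2.comp y h3, ?_⟩
      rw [← mfderiv_eq_fderiv, mfderiv_comp y (h2.mdifferentiableAt one_ne_zero)
        (h3.mdifferentiableAt one_ne_zero), mfderiv_comp y
        ((hf (ψ.symm y)).mdifferentiableAt one_ne_zero) (h1.mdifferentiableAt one_ne_zero)]
      rfl
    obtain ⟨V, hV, hVr⟩ :=
      ContDiffAt.exists_dimH_image_le_of_eventually_finrank_range_eq
        (hcomp _ (mem_of_mem_nhds ht)).1.contDiffAt (r := r) (by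
          filter_upwards [ht] with y hy
          rw [(hcomp y hy).2]
          refine (ContinuousLinearMap.IsInvertible.finrank_range_comp_comp (V₁ := F) (V₂ := F)
            (V₃ := E) (V₄ := E) (isInvertible_mfderiv_extChartAt hy.2) ?_ _).trans (hr _)
          have := isInvertible_mfderivWithin_extChartAt_symm (I := 𝓘(ℝ, F)) hy.1
          rwa [modelWithCornersSelf_coe, Set.range_id, mfderivWithin_univ] at this)
    refine ⟨ψ.source ∩ ψ ⁻¹' V, inter_mem (extChartAt_source_mem_nhds a)
      ((continuousAt_extChartAt a).preimage_mem_nhds hV), (dimH_mono ?_).trans hVr⟩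
    rintro _ ⟨_, ⟨b, ⟨hb, hb'⟩, rfl⟩, rfl⟩
    exact ⟨ψ b, hb', by simp [g, ψ.left_inv hb]⟩
  choose! U hU hUr using hloc
  obtain ⟨t, ht, htc, hcov⟩ := TopologicalSpace.countable_cover_nhdsWithin
    (f := U) (s := f ⁻¹' φ.source) (fun a ha => mem_nhdsWithin_of_mem_nhds (hU a ha))
  have hsub : φ.target ⊆ ⋃ a ∈ t, φ '' (f '' U a) := by
    intro y hy
    obtain ⟨b, hb⟩ := hsurj (φ.symm y)
    have hbS : b ∈ f ⁻¹' φ.source := by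
      rw [Set.mem_preimage, hb]; exact φ.map_target hy
    obtain ⟨a, ha, hba⟩ := Set.mem_iUnion₂.1 (hcov hbS)
    exact Set.mem_iUnion₂.2 ⟨a, ha, f b, ⟨b, hba, rfl⟩, by rw [hb, φ.right_inv hy]⟩
  have hle : dimH φ.target ≤ r := by
    refine (dimH_mono hsub).trans ?_
    rw [dimH_bUnion htc]
    exact iSup₂_le fun a ha => hUr a (ht ha)
  rw [Real.dimH_of_mem_nhds (extChartAt_target_mem_nhds (I := 𝓘(ℝ, E)) p)] at hle
  exact_mod_cast hle

/-! ### The orbit map of a smooth action -/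

namespace CRGeom

section OrbitMap

variable {F : Type*} [NormedAddCommGroup F] [NormedSpace ℝ F]
  {G : Type*} [TopologicalSpace G] [ChartedSpace F G] [Group G]
  {E : Type*} [NormedAddCommGroup E] [NormedSpace ℝ E]
  {M : Type*} [TopologicalSpace M] [ChartedSpace E M] [MulAction G M]

theorem contMDiff_smul_left
    (h : ContMDiff (𝓘(ℝ, F).prod 𝓘(ℝ, E)) 𝓘(ℝ, E) ∞ (fun p : G × M => p.1 • p.2)) (a : G) :
    ContMDiff 𝓘(ℝ, E) 𝓘(ℝ, E) ∞ (fun y : M => a • y) :=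
  h.comp (contMDiff_const.prodMk contMDiff_id)

theorem contMDiff_orbitMap
    (h : ContMDiff (𝓘(ℝ, F).prod 𝓘(ℝ, E)) 𝓘(ℝ, E) ∞ (fun p : G × M => p.1 • p.2)) (p : M) :
    ContMDiff 𝓘(ℝ, F) 𝓘(ℝ, E) ∞ (fun a : G => a • p) :=
  h.comp (contMDiff_id.prodMk contMDiff_const)

theorem isInvertible_mfderiv_smul_left
    (h : ContMDiff (𝓘(ℝ, F).prod 𝓘(ℝ, E)) 𝓘(ℝ, E) ∞ (fun p : G × M => p.1 • p.2)) (a : G) (x : M) :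
    (mfderiv 𝓘(ℝ, E) 𝓘(ℝ, E) (fun y : M => a • y) x).IsInvertible := by
  have hinf : (∞ : ℕ∞ω) ≠ 0 := by simp
  have key : ∀ (c d : G) (z w : M), c * d = 1 → d • z = w →
      (mfderiv 𝓘(ℝ, E) 𝓘(ℝ, E) (fun y : M => c • y) w : E →L[ℝ] E).comp
        (mfderiv 𝓘(ℝ, E) 𝓘(ℝ, E) (fun y : M => d • y) z : E →L[ℝ] E) =
          ContinuousLinearMap.id ℝ E := by
    rintro c d z _ hcd rfl
    have h1 : (fun y : M => c • y) ∘ (fun y : M => d • y) = id := by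
      ext y; simp [smul_smul, hcd]
    have := mfderiv_comp z ((contMDiff_smul_left h c (d • z)).mdifferentiableAt hinf)
      ((contMDiff_smul_left h d z).mdifferentiableAt hinf)
    rw [h1, mfderiv_id] at this
    exact this.symm
  exact ContinuousLinearMap.IsInvertible.of_inverse (g := mfderiv 𝓘(ℝ, E) 𝓘(ℝ, E)
    (fun y : M => a⁻¹ • y) (a • x)) (key a a⁻¹ (a • x) x (mul_inv_cancel a) (inv_smul_smul a x))
    (key a⁻¹ a x (a • x) (inv_mul_cancel a) rfl)

variable [LieGroup 𝓘(ℝ, F) ∞ G]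

/-- The differentiated form of the equivariance `π (a b) = a • π b` of the orbit map `π`. -/
theorem mfderiv_orbitMap_mulInvariantVectorField
    (h : ContMDiff (𝓘(ℝ, F).prod 𝓘(ℝ, E)) 𝓘(ℝ, E) ∞ (fun p : G × M => p.1 • p.2)) (p : M)
    (a : G) (v : GroupLieAlgebra 𝓘(ℝ, F) G) :
    mfderiv 𝓘(ℝ, F) 𝓘(ℝ, E) (fun b : G => b • p) a (mulInvariantVectorField v a) =
      mfderiv 𝓘(ℝ, E) 𝓘(ℝ, E) (fun y : M => a • y) p (orbitDeriv F G p v) := by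
  have hinf : (∞ : ℕ∞ω) ≠ 0 := by simp
  have h1 : (fun b : G => b • p) ∘ (fun b => a * b) =
      (fun y : M => a • y) ∘ fun b : G => b • p := by
    ext b; simp [mul_smul]
  have e1 := mfderiv_comp (1 : G)
    ((contMDiff_orbitMap h p (a * 1)).mdifferentiableAt hinf)
    ((contMDiff_mul_left (I := 𝓘(ℝ, F)) (n := ∞) (a := a) 1).mdifferentiableAt hinf)
  have e2 := mfderiv_comp (1 : G)
    ((contMDiff_smul_left h a ((1 : G) • p)).mdifferentiableAt hinf)
    ((contMDiff_orbitMap h p 1).mdifferentiableAt hinf)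
  rw [h1, e2] at e1
  have e3 := DFunLike.congr_fun e1 v
  have h2 : ∀ b : G, b = a → ∀ w : F,
      (mfderiv 𝓘(ℝ, F) 𝓘(ℝ, E) (fun b : G => b • p) b w : E) =
        mfderiv 𝓘(ℝ, F) 𝓘(ℝ, E) (fun b : G => b • p) a w := by rintro _ rfl w; rfl
  have h3 : ∀ x : M, x = p → ∀ w : E,
      (mfderiv 𝓘(ℝ, E) 𝓘(ℝ, E) (fun y : M => a • y) x w : E) =
        mfderiv 𝓘(ℝ, E) 𝓘(ℝ, E) (fun y : M => a • y) p w := by rintro _ rfl w; rfl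
  exact ((h2 _ (mul_one a) _).symm.trans e3.symm).trans (h3 _ (one_smul G p) _)

variable [IsManifold 𝓘(ℝ, E) ∞ M]

/-- The orbit map of a smooth transitive action of a second countable Lie group is a submersion. -/
theorem orbitDeriv_surjective [FiniteDimensional ℝ F] [SecondCountableTopology G]
    [FiniteDimensional ℝ E]
    (h : ContMDiff (𝓘(ℝ, F).prod 𝓘(ℝ, E)) 𝓘(ℝ, E) ∞ (fun p : G × M => p.1 • p.2))
    (htr : ∀ x y : M, ∃ a : G, a • x = y) (p : M) :
    Function.Surjective (orbitDeriv (E := E) F G p) := by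
  have : IsManifold 𝓘(ℝ, F) 1 G := IsManifold.of_le (n := ∞) (by simp)
  have : IsManifold 𝓘(ℝ, E) 1 M := IsManifold.of_le (n := ∞) (by simp)
  have hrank : ∀ a : G,
      Module.finrank ℝ (mfderiv 𝓘(ℝ, F) 𝓘(ℝ, E) (fun b : G => b • p) a).range =
        Module.finrank ℝ (LinearMap.range (orbitDeriv (E := E) F G p)) := by
    intro a
    obtain ⟨e, he⟩ := isInvertible_mfderiv_smul_left h a p
    obtain ⟨c, hc⟩ := isInvertible_mfderiv_smul_left (M := G) (contMDiff_mul 𝓘(ℝ, F) ∞) a 1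
    have heq : ∀ v : F, mfderiv 𝓘(ℝ, F) 𝓘(ℝ, E) (fun b : G => b • p) a (c v) =
        e (orbitDeriv F G p v) := by
      intro v
      have := mfderiv_orbitMap_mulInvariantVectorField h p a v
      rw [← he] at this
      refine Eq.trans ?_ this
      congr 1
      exact DFunLike.congr_fun hc v
    have hmap : (mfderiv 𝓘(ℝ, F) 𝓘(ℝ, E) (fun b : G => b • p) a).range =
        (LinearMap.range (orbitDeriv (E := E) F G p)).map e.toLinearEquiv.toLinearMap := by
      ext w
      constructor
      · rintro ⟨v, rfl⟩
        refine ⟨_, ⟨c.symm v, rfl⟩, ?_⟩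
        exact (heq _).symm.trans (congrArg _ (c.apply_symm_apply v))
      · rintro ⟨_, ⟨v, rfl⟩, rfl⟩
        exact ⟨c v, heq v⟩
    rw [hmap]
    exact LinearEquiv.finrank_map_eq e.toLinearEquiv _
  have hle := ((contMDiff_orbitMap h p).of_le (by simp)
    ).finrank_le_of_surjective_of_finrank_range_mfderiv_eq (htr p) hrank p
  have : FiniteDimensional ℝ (TangentSpace 𝓘(ℝ, E) p) := inferInstanceAs (FiniteDimensional ℝ E)
  rw [← LinearMap.range_eq_top]
  exact Submodule.eq_top_of_finrank_eq (le_antisymm (Submodule.finrank_le _) hle)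

end OrbitMap

end CRGeom

/-! ### Lie brackets and maps between manifolds -/

open VectorField in
/-- The defect of `fderiv ℝ f` to preserve brackets, for vector fields which are `f`-related only
at the point `x`; the second derivative of `f` does not contribute because it is symmetric. -/
theorem VectorField.fderiv_lieBracket_sub_lieBracket
    {F E : Type*} [NormedAddCommGroup F] [NormedSpace ℝ F] [NormedAddCommGroup E] [NormedSpace ℝ E]
    {f : F → E} {x : F} (hf : ContDiffAt ℝ 2 f x) {V₁ V₂ : F → F} {W₁ W₂ : E → E}
    (hV₁ : DifferentiableAt ℝ V₁ x) (hV₂ : DifferentiableAt ℝ V₂ x)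
    (hW₁ : DifferentiableAt ℝ W₁ (f x)) (hW₂ : DifferentiableAt ℝ W₂ (f x))
    (h₁ : fderiv ℝ f x (V₁ x) = W₁ (f x)) (h₂ : fderiv ℝ f x (V₂ x) = W₂ (f x)) :
    fderiv ℝ f x (lieBracket ℝ V₁ V₂ x) - lieBracket ℝ W₁ W₂ (f x) =
      fderiv ℝ (fun y => fderiv ℝ f y (V₂ y) - W₂ (f y)) x (V₁ x) -
        fderiv ℝ (fun y => fderiv ℝ f y (V₁ y) - W₁ (f y)) x (V₂ x) := by
  have hfx : HasFDerivAt f (fderiv ℝ f x) x :=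
    (hf.differentiableAt two_ne_zero).hasFDerivAt
  have hdf : HasFDerivAt (fderiv ℝ f) (fderiv ℝ (fderiv ℝ f) x) x :=
    ((hf.fderiv_right (m := 1) (by norm_num)).differentiableAt one_ne_zero).hasFDerivAt
  have key : ∀ {V : F → F} {W : E → E}, DifferentiableAt ℝ V x → DifferentiableAt ℝ W (f x) →
      ∀ v, fderiv ℝ (fun y => fderiv ℝ f y (V y) - W (f y)) x v =
        fderiv ℝ f x (fderiv ℝ V x v) + fderiv ℝ (fderiv ℝ f) x v (V x) -
          fderiv ℝ W (f x) (fderiv ℝ f x v) := by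
    intro V W hV hW v
    have h := (hdf.clm_apply hV.hasFDerivAt).sub (hW.hasFDerivAt.comp x hfx)
    have h' := h.fderiv
    simp only [Function.comp_def] at h'
    have h'' : fderiv ℝ (fun y => fderiv ℝ f y (V y) - W (f y)) x = _ := h'
    rw [h'']
    simp
  have hsymm : fderiv ℝ (fderiv ℝ f) x (V₁ x) (V₂ x) = fderiv ℝ (fderiv ℝ f) x (V₂ x) (V₁ x) :=
    (hf.isSymmSndFDerivAt (by simp)).eq _ _
  rw [key hV₂ hW₂, key hV₁ hW₁, lieBracket, lieBracket, h₁, h₂, hsymm, map_sub]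
  abel

namespace CRGeom

open VectorField

section Coordinates

variable {E : Type*} [NormedAddCommGroup E] [NormedSpace ℝ E]
  {M : Type*} [TopologicalSpace M] [ChartedSpace E M]

/-- The vector field `Y` read in the chart at `p`. -/
noncomputable def coordField (p : M) (Y : ∀ x : M, TangentSpace 𝓘(ℝ, E) x) : E → E :=
  mpullback 𝓘(ℝ, E) 𝓘(ℝ, E) (extChartAt 𝓘(ℝ, E) p).symm Y

theorem mlieBracket_eq_lieBracket_coordField [IsManifold 𝓘(ℝ, E) 1 M] (p : M)
    (Y₁ Y₂ : ∀ x : M, TangentSpace 𝓘(ℝ, E) x) :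
    mlieBracket 𝓘(ℝ, E) Y₁ Y₂ p =
      lieBracket ℝ (coordField p Y₁) (coordField p Y₂) (extChartAt 𝓘(ℝ, E) p p) := by
  rw [← mlieBracketWithin_univ, mlieBracketWithin_apply, mfderiv_extChartAt_self]
  simp only [modelWithCornersSelf_coe, Set.range_id, Set.preimage_univ, Set.inter_univ,
    mpullbackWithin_univ]
  erw [ContinuousLinearMap.inverse_id]
  exact congrFun (lieBracketWithin_univ (𝕜 := ℝ) (V := coordField p Y₁) (W := coordField p Y₂)) _

theorem coordField_apply [IsManifold 𝓘(ℝ, E) 1 M] {p : M} {y : E}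
    (hy : y ∈ (extChartAt 𝓘(ℝ, E) p).target) (Y : ∀ x : M, TangentSpace 𝓘(ℝ, E) x) :
    coordField p Y y = mfderiv 𝓘(ℝ, E) 𝓘(ℝ, E) (extChartAt 𝓘(ℝ, E) p)
      ((extChartAt 𝓘(ℝ, E) p).symm y) (Y ((extChartAt 𝓘(ℝ, E) p).symm y)) := by
  have h1 := isInvertible_mfderivWithin_extChartAt_symm (I := 𝓘(ℝ, E)) hy
  have h2 := mfderivWithin_extChartAt_symm_comp_mfderiv_extChartAt (I := 𝓘(ℝ, E)) hy
  rw [modelWithCornersSelf_coe, Set.range_id, mfderivWithin_univ] at h1 h2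
  exact h1.inverse_apply_eq.2 (DFunLike.congr_fun h2 _).symm

theorem contDiffAt_coordField [CompleteSpace E] [IsManifold 𝓘(ℝ, E) 2 M] {p : M}
    {Y : ∀ x : M, TangentSpace 𝓘(ℝ, E) x}
    (hY : ContMDiffAt 𝓘(ℝ, E) 𝓘(ℝ, E).tangent 1 (fun x => (⟨x, Y x⟩ : TangentBundle 𝓘(ℝ, E) M)) p) :
    ContDiffAt ℝ 1 (coordField p Y) (extChartAt 𝓘(ℝ, E) p p) := by
  have h := contMDiffWithinAt_mpullbackWithin_extChartAt_symm (n := 2) (m := 1)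
    (s := Set.univ) hY.contMDiffWithinAt uniqueMDiffOn_univ (Set.mem_univ p) (by norm_num)
  rw [contMDiffWithinAt_vectorSpace_iff_contDiffWithinAt] at h
  simp only [modelWithCornersSelf_coe, Set.range_id, Set.preimage_univ, Set.inter_univ,
    mpullbackWithin_univ] at h
  exact h.contDiffAt (extChartAt_target_mem_nhds p)

end Coordinates

section Along

variable {F : Type*} [NormedAddCommGroup F] [NormedSpace ℝ F]
  {N : Type*} [TopologicalSpace N] [ChartedSpace F N]
  {E : Type*} [NormedAddCommGroup E] [NormedSpace ℝ E]
  {M : Type*} [TopologicalSpace M] [ChartedSpace E M]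

/-- A vector field `e` along a map `f : N → M`, read in the charts at `a` and at `f a`. -/
noncomputable def coordAlong (f : N → M) (e : ∀ b : N, TangentSpace 𝓘(ℝ, E) (f b)) (a : N) :
    F → E := fun y =>
  mfderiv 𝓘(ℝ, E) 𝓘(ℝ, E) (extChartAt 𝓘(ℝ, E) (f a)) (f ((extChartAt 𝓘(ℝ, F) a).symm y))
    (e ((extChartAt 𝓘(ℝ, F) a).symm y))

/-- The failure at `b` of the vector fields `X` on `N` and `Y` on `M` to be `f`-related. -/
noncomputable def relDefect (f : N → M) (X : ∀ b : N, TangentSpace 𝓘(ℝ, F) b)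
    (Y : ∀ x : M, TangentSpace 𝓘(ℝ, E) x) (b : N) : TangentSpace 𝓘(ℝ, E) (f b) :=
  mfderiv 𝓘(ℝ, F) 𝓘(ℝ, E) f b (X b) - Y (f b)

variable [IsManifold 𝓘(ℝ, F) 2 N] [IsManifold 𝓘(ℝ, E) 2 M]

theorem coordAlong_relDefect_eventuallyEq {f : N → M} {a : N}
    (hf : ContMDiff 𝓘(ℝ, F) 𝓘(ℝ, E) 2 f) (X : ∀ b : N, TangentSpace 𝓘(ℝ, F) b)
    (Y : ∀ x : M, TangentSpace 𝓘(ℝ, E) x) :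
    coordAlong f (relDefect f X Y) a =ᶠ[𝓝 (extChartAt 𝓘(ℝ, F) a a)] fun y =>
      fderiv ℝ (extChartAt 𝓘(ℝ, E) (f a) ∘ f ∘ (extChartAt 𝓘(ℝ, F) a).symm) y (coordField a X y) -
        coordField (f a) Y (extChartAt 𝓘(ℝ, E) (f a) (f ((extChartAt 𝓘(ℝ, F) a).symm y))) := by
  set φ := extChartAt 𝓘(ℝ, E) (f a)
  set ψ := extChartAt 𝓘(ℝ, F) a
  have ht : ψ.target ∩ ψ.symm ⁻¹' (f ⁻¹' φ.source) ∈ 𝓝 (ψ a) :=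
    Filter.inter_mem (extChartAt_target_mem_nhds a) <|
      (continuousAt_extChartAt_symm (I := 𝓘(ℝ, F)) a).preimage_mem_nhds <| by
        rw [extChartAt_to_inv]
        exact hf.continuous.continuousAt.preimage_mem_nhds (extChartAt_source_mem_nhds (f a))
  filter_upwards [ht] with y ⟨hy, hy'⟩
  have h1 : ContMDiffAt 𝓘(ℝ, F) 𝓘(ℝ, F) 1 ψ.symm y :=
    (contMDiffOn_extChartAt_symm a).contMDiffAt
      ((isOpen_extChartAt_target (I := 𝓘(ℝ, F)) a).mem_nhds hy)
  have h2 : ContMDiffAt 𝓘(ℝ, E) 𝓘(ℝ, E) 1 φ (f (ψ.symm y)) :=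
    contMDiffAt_extChartAt' (by simpa [φ] using hy')
  have h3 := ((hf.of_le one_le_two) (ψ.symm y)).comp y h1
  rw [← mfderiv_eq_fderiv, mfderiv_comp y (h2.mdifferentiableAt one_ne_zero)
    (h3.mdifferentiableAt one_ne_zero), mfderiv_comp y
    ((hf (ψ.symm y)).mdifferentiableAt two_ne_zero) (h1.mdifferentiableAt one_ne_zero)]
  have h4 := mfderivWithin_extChartAt_symm_comp_mfderiv_extChartAt (I := 𝓘(ℝ, F)) hy
  rw [modelWithCornersSelf_coe, Set.range_id, mfderivWithin_univ] at h4
  have h5 : mfderiv 𝓘(ℝ, F) 𝓘(ℝ, F) ψ.symm y (coordField (E := F) a X y) = X (ψ.symm y) := by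
    rw [coordField_apply hy]
    exact DFunLike.congr_fun h4 _
  have h6 := coordField_apply (φ.map_source hy') Y
  rw [φ.left_inv hy'] at h6
  have h7 : coordAlong f (relDefect f X Y) a y =
      mfderiv 𝓘(ℝ, E) 𝓘(ℝ, E) φ (f (ψ.symm y))
        (mfderiv 𝓘(ℝ, F) 𝓘(ℝ, E) f (ψ.symm y) (X (ψ.symm y)) - Y (f (ψ.symm y))) := rfl
  rw [h7, h6, map_sub, ← h5]
  rfl

end Along

section

variable {F : Type*} [NormedAddCommGroup F] [NormedSpace ℝ F]
  {N : Type*} [TopologicalSpace N] [ChartedSpace F N]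
  {E : Type*} [NormedAddCommGroup E] [NormedSpace ℝ E]
  {M : Type*} [TopologicalSpace M] [ChartedSpace E M]

theorem coordField_extChartAt_self [IsManifold 𝓘(ℝ, E) 1 M] (p : M)
    (Y : ∀ x : M, TangentSpace 𝓘(ℝ, E) x) :
    coordField p Y (extChartAt 𝓘(ℝ, E) p p) = Y p := by
  have h : ∀ q : M, q = p → mfderiv 𝓘(ℝ, E) 𝓘(ℝ, E) (extChartAt 𝓘(ℝ, E) p) q (Y q) = Y p := by
    rintro _ rfl
    rw [mfderiv_extChartAt_self]
    rfl
  rw [coordField_apply (mem_extChartAt_target p)]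
  exact h _ (extChartAt_to_inv p)

theorem contDiffAt_extChartAt_comp_comp_symm {f : N → M} {a : N}
    (hf : ContMDiff 𝓘(ℝ, F) 𝓘(ℝ, E) 2 f) :
    ContDiffAt ℝ 2 (extChartAt 𝓘(ℝ, E) (f a) ∘ f ∘ (extChartAt 𝓘(ℝ, F) a).symm)
      (extChartAt 𝓘(ℝ, F) a a) := by
  have h := (contMDiffAt_iff.1 (hf a)).2
  rwa [modelWithCornersSelf_coe, Set.range_id, contDiffWithinAt_univ] at h

theorem mfderiv_eq_fderiv_extChartAt_comp_comp_symm {f : N → M} {a : N}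
    (hf : ContMDiff 𝓘(ℝ, F) 𝓘(ℝ, E) 2 f) (v : F) :
    mfderiv 𝓘(ℝ, F) 𝓘(ℝ, E) f a v =
      fderiv ℝ (extChartAt 𝓘(ℝ, E) (f a) ∘ f ∘ (extChartAt 𝓘(ℝ, F) a).symm)
        (extChartAt 𝓘(ℝ, F) a a) v := by
  rw [((hf a).mdifferentiableAt two_ne_zero).mfderiv, modelWithCornersSelf_coe, Set.range_id,
    fderivWithin_univ]
  rfl

/-- A real vector field is continuously differentiable at the given point. -/
abbrev FieldC1At [IsManifold 𝓘(ℝ, E) 1 M] (Y : ∀ x : M, TangentSpace 𝓘(ℝ, E) x) (p : M) : Prop :=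
  ContMDiffAt 𝓘(ℝ, E) 𝓘(ℝ, E).tangent 1 (fun x => (⟨x, Y x⟩ : TangentBundle 𝓘(ℝ, E) M)) p

variable [IsManifold 𝓘(ℝ, F) 2 N] [IsManifold 𝓘(ℝ, E) 2 M] [CompleteSpace F] [CompleteSpace E]

theorem differentiableAt_coordAlong_relDefect {f : N → M} {a : N}
    (hf : ContMDiff 𝓘(ℝ, F) 𝓘(ℝ, E) 2 f) {X : ∀ b : N, TangentSpace 𝓘(ℝ, F) b}
    {Y : ∀ x : M, TangentSpace 𝓘(ℝ, E) x} (hX : FieldC1At X a) (hY : FieldC1At Y (f a)) :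
    DifferentiableAt ℝ (coordAlong f (relDefect f X Y) a) (extChartAt 𝓘(ℝ, F) a a) := by
  have h2 := contDiffAt_extChartAt_comp_comp_symm (a := a) hf
  have hY' : DifferentiableAt ℝ (coordField (f a) Y)
      ((extChartAt 𝓘(ℝ, E) (f a) ∘ f ∘ (extChartAt 𝓘(ℝ, F) a).symm) (extChartAt 𝓘(ℝ, F) a a)) := by
    simp only [Function.comp_apply, extChartAt_to_inv]
    exact (contDiffAt_coordField hY).differentiableAt one_ne_zero
  refine DifferentiableAt.congr_of_eventuallyEq ?_ (coordAlong_relDefect_eventuallyEq hf X Y)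
  exact (((h2.fderiv_right (m := 1) (by norm_num)).differentiableAt one_ne_zero).clm_apply
    ((contDiffAt_coordField hX).differentiableAt one_ne_zero)).sub
      (hY'.comp _ (h2.differentiableAt two_ne_zero))

/-- The bracket of vector fields which are `f`-related at a point `a` is preserved by the
differential of `f` up to derivatives of the defects of the fields to be `f`-related. As these
defects vanish at `a`, their derivatives at `a` do not depend on the charts. -/
theorem mfderiv_mlieBracket_sub_mlieBracket {f : N → M} {a : N}
    (hf : ContMDiff 𝓘(ℝ, F) 𝓘(ℝ, E) 2 f) {X₁ X₂ : ∀ b : N, TangentSpace 𝓘(ℝ, F) b}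
    {Y₁ Y₂ : ∀ x : M, TangentSpace 𝓘(ℝ, E) x} (hX₁ : FieldC1At X₁ a) (hX₂ : FieldC1At X₂ a)
    (hY₁ : FieldC1At Y₁ (f a)) (hY₂ : FieldC1At Y₂ (f a))
    (h₁ : mfderiv 𝓘(ℝ, F) 𝓘(ℝ, E) f a (X₁ a) = Y₁ (f a))
    (h₂ : mfderiv 𝓘(ℝ, F) 𝓘(ℝ, E) f a (X₂ a) = Y₂ (f a)) :
    mfderiv 𝓘(ℝ, F) 𝓘(ℝ, E) f a (mlieBracket 𝓘(ℝ, F) X₁ X₂ a) -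
        mlieBracket 𝓘(ℝ, E) Y₁ Y₂ (f a) =
      fderiv ℝ (coordAlong f (relDefect f X₂ Y₂) a) (extChartAt 𝓘(ℝ, F) a a) (X₁ a) -
        fderiv ℝ (coordAlong f (relDefect f X₁ Y₁) a) (extChartAt 𝓘(ℝ, F) a a) (X₂ a) := by
  have h2 := contDiffAt_extChartAt_comp_comp_symm (a := a) hf
  have hfa : (extChartAt 𝓘(ℝ, E) (f a) ∘ f ∘ (extChartAt 𝓘(ℝ, F) a).symm)
      (extChartAt 𝓘(ℝ, F) a a) = extChartAt 𝓘(ℝ, E) (f a) (f a) := by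
    simp only [Function.comp_apply, extChartAt_to_inv]
  have dX : ∀ {X : ∀ b : N, TangentSpace 𝓘(ℝ, F) b}, FieldC1At X a →
      DifferentiableAt ℝ (coordField a X) (extChartAt 𝓘(ℝ, F) a a) :=
    fun h => (contDiffAt_coordField h).differentiableAt one_ne_zero
  have dY : ∀ {Y : ∀ x : M, TangentSpace 𝓘(ℝ, E) x}, FieldC1At Y (f a) →
      DifferentiableAt ℝ (coordField (f a) Y)
        ((extChartAt 𝓘(ℝ, E) (f a) ∘ f ∘ (extChartAt 𝓘(ℝ, F) a).symm)
          (extChartAt 𝓘(ℝ, F) a a)) := fun h => by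
    rw [hfa]; exact (contDiffAt_coordField h).differentiableAt one_ne_zero
  have hrel : ∀ {X : ∀ b : N, TangentSpace 𝓘(ℝ, F) b} {Y : ∀ x : M, TangentSpace 𝓘(ℝ, E) x},
      mfderiv 𝓘(ℝ, F) 𝓘(ℝ, E) f a (X a) = Y (f a) →
      fderiv ℝ (extChartAt 𝓘(ℝ, E) (f a) ∘ f ∘ (extChartAt 𝓘(ℝ, F) a).symm)
        (extChartAt 𝓘(ℝ, F) a a) (coordField a X (extChartAt 𝓘(ℝ, F) a a)) =
      coordField (f a) Y ((extChartAt 𝓘(ℝ, E) (f a) ∘ f ∘ (extChartAt 𝓘(ℝ, F) a).symm)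
        (extChartAt 𝓘(ℝ, F) a a)) := by
    intro X Y h
    rw [hfa, coordField_extChartAt_self, coordField_extChartAt_self]
    exact (mfderiv_eq_fderiv_extChartAt_comp_comp_symm hf (X a)).symm.trans h
  have key := fderiv_lieBracket_sub_lieBracket h2 (dX hX₁) (dX hX₂) (dY hY₁) (dY hY₂)
    (hrel h₁) (hrel h₂)
  rw [(coordAlong_relDefect_eventuallyEq hf X₂ Y₂).fderiv_eq,
    (coordAlong_relDefect_eventuallyEq hf X₁ Y₁).fderiv_eq,
    mlieBracket_eq_lieBracket_coordField, mlieBracket_eq_lieBracket_coordField]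
  rw [hfa, coordField_extChartAt_self, coordField_extChartAt_self] at key
  exact (congrArg (fun z : E => z - _) (mfderiv_eq_fderiv_extChartAt_comp_comp_symm hf _)).trans key

end

/-! ### Real and imaginary parts, and limits of complex spans -/

section Complexification

variable {V W : Type*} [AddCommGroup V] [Module ℝ V] [AddCommGroup W] [Module ℝ W]

theorem one_tmul_reC_add_I_tmul_imC (x : ℂ ⊗[ℝ] V) :
    (1 : ℂ) ⊗ₜ[ℝ] reC V x + Complex.I ⊗ₜ[ℝ] imC V x = x := by
  induction x using TensorProduct.induction_on with
  | zero => simp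
  | tmul a v =>
    rw [reC_tmul, imC_tmul, ← TensorProduct.smul_tmul, ← TensorProduct.smul_tmul,
      ← TensorProduct.add_tmul]
    congr 1
    apply Complex.ext <;> simp
  | add x y hx hy =>
    conv_rhs => rw [← hx, ← hy]
    simp only [map_add, TensorProduct.tmul_add]
    abel

theorem reC_baseChange (f : V →ₗ[ℝ] W) (x : ℂ ⊗[ℝ] V) :
    reC W (f.baseChange ℂ x) = f (reC V x) := by
  induction x using TensorProduct.induction_on with
  | zero => simp
  | tmul a v => simp
  | add x y hx hy => simp only [map_add, hx, hy]

theorem imC_baseChange (f : V →ₗ[ℝ] W) (x : ℂ ⊗[ℝ] V) :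
    imC W (f.baseChange ℂ x) = f (imC V x) := by
  induction x using TensorProduct.induction_on with
  | zero => simp
  | tmul a v => simp
  | add x y hx hy => simp only [map_add, hx, hy]

@[simp] theorem reC_conjC (x : ℂ ⊗[ℝ] V) : reC V (conjC V x) = reC V x := by
  induction x using TensorProduct.induction_on with
  | zero => simp
  | tmul a v => simp
  | add x y hx hy => simp only [map_add, hx, hy]

@[simp] theorem imC_conjC (x : ℂ ⊗[ℝ] V) : imC V (conjC V x) = -imC V x := by
  induction x using TensorProduct.induction_on with
  | zero => simp
  | tmul a v => simp
  | add x y hx hy => simp only [map_add, hx, hy, neg_add]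

theorem reC_mk (u w : V) : reC V ((1 : ℂ) ⊗ₜ[ℝ] u + Complex.I ⊗ₜ[ℝ] w) = u := by simp

theorem imC_mk (u w : V) : imC V ((1 : ℂ) ⊗ₜ[ℝ] u + Complex.I ⊗ₜ[ℝ] w) = w := by simp

end Complexification

open Filter in
/-- A limit of vectors in the range of `A i` lies in the range of the limit `A₀` of the linear maps
`A i` if `A₀` is injective: with a left inverse `B` of `A₀`, vectors `e i` in the range of `A i`
are `A i ((B A i)⁻¹ (B (e i)))`. -/
theorem mem_range_of_tendsto {ι H₁ H₂ : Type*} [NormedAddCommGroup H₁] [NormedSpace ℝ H₁]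
    [FiniteDimensional ℝ H₁] [NormedAddCommGroup H₂] [NormedSpace ℝ H₂] [FiniteDimensional ℝ H₂]
    {l : Filter ι} [l.NeBot] {A : ι → H₁ →L[ℝ] H₂} {A₀ : H₁ →L[ℝ] H₂}
    (hA : Tendsto A l (𝓝 A₀)) (hinj : Function.Injective A₀) {e : ι → H₂} {e₀ : H₂}
    (he : Tendsto e l (𝓝 e₀)) (hmem : ∀ᶠ i in l, e i ∈ Set.range (A i)) :
    e₀ ∈ Set.range A₀ := by
  have := FiniteDimensional.complete ℝ H₁
  obtain ⟨B₀, hB₀⟩ := A₀.toLinearMap.exists_leftInverse_of_injective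
    (LinearMap.ker_eq_bot.2 hinj)
  let B : H₂ →L[ℝ] H₁ := B₀.toContinuousLinearMap
  have hB : B.comp A₀ = ContinuousLinearMap.id ℝ H₁ := by
    ext v; exact LinearMap.congr_fun hB₀ v
  have hBA : Tendsto (fun i => B.comp (A i)) l (𝓝 (ContinuousLinearMap.id ℝ H₁)) := by
    rw [← hB]
    exact (((ContinuousLinearMap.compL ℝ H₁ H₂ H₁ B).continuous.tendsto A₀).comp hA)
  have hid : (ContinuousLinearMap.id ℝ H₁).IsInvertible := ⟨.refl ℝ H₁, rfl⟩
  have hinv : Tendsto (fun i => (B.comp (A i)).inverse) l (𝓝 (ContinuousLinearMap.id ℝ H₁)) := by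
    have h := (hid.contDiffAt_map_inverse (n := 0)).continuousAt.tendsto
    rw [ContinuousLinearMap.inverse_id] at h
    exact h.comp hBA
  have hunit : ∀ᶠ i in l, (B.comp (A i)).IsInvertible :=
    hBA.eventually ((ContinuousLinearEquiv.refl ℝ H₁).nhds)
  have hlim : Tendsto (fun i => A i ((B.comp (A i)).inverse (B (e i)))) l (𝓝 (A₀ (B e₀))) :=
    (isBoundedBilinearMap_apply.continuous.tendsto (A₀, B e₀)).comp <| hA.prodMk_nhds <|
      (isBoundedBilinearMap_apply.continuous.tendsto (ContinuousLinearMap.id ℝ H₁, B e₀)).comp <|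
        hinv.prodMk_nhds ((B.continuous.tendsto e₀).comp he)
  refine ⟨B e₀, tendsto_nhds_unique hlim (he.congr' ?_)⟩
  filter_upwards [hmem, hunit] with i ⟨c, hc⟩ hi
  have h1 : (B.comp (A i)).inverse (B (e i)) = c := by
    rw [hi.inverse_apply_eq, ← hc]
    rfl
  rw [h1, hc]

open Filter in
/-- A limit of vectors in the complex span of frames lies in the span of the limit of the frames,
if this limit is linearly independent. -/
theorem mem_span_of_tendsto {ι V : Type*} [NormedAddCommGroup V] [NormedSpace ℝ V]
    [FiniteDimensional ℝ V] {l : Filter ι} [l.NeBot] {n : ℕ} {L : Fin n → ι → ℂ ⊗[ℝ] V}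
    {L₀ : Fin n → ℂ ⊗[ℝ] V} (hind : LinearIndependent ℂ L₀)
    (hre : ∀ j, Tendsto (fun i => reC V (L j i)) l (𝓝 (reC V (L₀ j))))
    (him : ∀ j, Tendsto (fun i => imC V (L j i)) l (𝓝 (imC V (L₀ j))))
    {e : ι → ℂ ⊗[ℝ] V} {u w : V}
    (hu : Tendsto (fun i => reC V (e i)) l (𝓝 u)) (hw : Tendsto (fun i => imC V (e i)) l (𝓝 w))
    (hmem : ∀ᶠ i in l, e i ∈ Submodule.span ℂ (Set.range fun j => L j i)) :
    (1 : ℂ) ⊗ₜ[ℝ] u + Complex.I ⊗ₜ[ℝ] w ∈ Submodule.span ℂ (Set.range L₀) := by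
  -- the map `c ↦ ∑ j, c j • L j`, in terms of real and imaginary parts
  let T : (Fin n → V × V) → (Fin n → ℂ) →L[ℝ] V × V := fun Q => ∑ j,
    ((Complex.reCLM.comp (ContinuousLinearMap.proj (R := ℝ) j)).smulRight (Q j) +
      (Complex.imCLM.comp (ContinuousLinearMap.proj (R := ℝ) j)).smulRight (-(Q j).2, (Q j).1))
  have hT : ∀ (Λ : Fin n → ℂ ⊗[ℝ] V) (c : Fin n → ℂ),
      T (fun j => (reC V (Λ j), imC V (Λ j))) c =
        (reC V (∑ j, c j • Λ j), imC V (∑ j, c j • Λ j)) := by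
    intro Λ c
    simp only [map_sum, reC_smul, imC_smul]
    simp only [T, sum_apply]
    refine Prod.ext ?_ ?_
    · rw [Prod.fst_sum]
      exact Finset.sum_congr rfl fun j _ => by simp [sub_eq_add_neg]
    · rw [Prod.snd_sum]
      exact Finset.sum_congr rfl fun j _ => by simp
  have hTc : Continuous T := by
    refine continuous_finsetSum _ fun j _ => ?_
    refine Continuous.add ?_ ?_
    · exact (ContinuousLinearMap.smulRightL ℝ (Fin n → ℂ) (V × V) _).continuous.comp
        (continuous_apply j)
    · exact (ContinuousLinearMap.smulRightL ℝ (Fin n → ℂ) (V × V) _).continuous.comp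
        (by fun_prop : Continuous fun Q : Fin n → V × V => (-(Q j).2, (Q j).1))
  have hlim : Tendsto (fun i => T (fun j => (reC V (L j i), imC V (L j i)))) l
      (𝓝 (T (fun j => (reC V (L₀ j), imC V (L₀ j))))) :=
    (hTc.tendsto _).comp (tendsto_pi_nhds.2 fun j => (hre j).prodMk_nhds (him j))
  have hinj : Function.Injective (T (fun j => (reC V (L₀ j), imC V (L₀ j)))) := by
    refine (injective_iff_map_eq_zero _).2 fun c hc => ?_
    rw [hT, Prod.mk_eq_zero] at hc
    have h1 : ∑ j, c j • L₀ j = 0 := by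
      rw [← one_tmul_reC_add_I_tmul_imC (∑ j, c j • L₀ j), hc.1, hc.2]
      simp
    exact funext fun j => Fintype.linearIndependent_iff.1 hind c h1 j
  obtain ⟨c, hc⟩ := mem_range_of_tendsto hlim hinj (hu.prodMk_nhds hw) (by
    filter_upwards [hmem] with i hi
    obtain ⟨c, hc⟩ := (Submodule.mem_span_range_iff_exists_fun ℂ).1 hi
    exact ⟨c, by rw [hT, hc]⟩)
  rw [hT, Prod.mk.injEq] at hc
  rw [← hc.1, ← hc.2, one_tmul_reC_add_I_tmul_imC]
  exact (Submodule.mem_span_range_iff_exists_fun ℂ).2 ⟨c, rfl⟩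

/-! ### Complex vector fields along a map -/

section ComplexAlong

variable {F : Type*} [NormedAddCommGroup F] [NormedSpace ℝ F]
  {N : Type*} [TopologicalSpace N] [ChartedSpace F N]
  {E : Type*} [NormedAddCommGroup E] [NormedSpace ℝ E]
  {M : Type*} [TopologicalSpace M] [ChartedSpace E M]

/-- The derivative at `a` of a vector field `e` along `f : N → M`, computed in the charts at `a`
and `f a`. It has an intrinsic meaning when `e a = 0`. -/
noncomputable def realDerivAlong (f : N → M) (e : ∀ b : N, TangentSpace 𝓘(ℝ, E) (f b)) (a : N) :
    TangentSpace 𝓘(ℝ, F) a →ₗ[ℝ] TangentSpace 𝓘(ℝ, E) (f a) :=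
  (fderiv ℝ (coordAlong f e a) (extChartAt 𝓘(ℝ, F) a a)).toLinearMap

/-- The derivative at `a` in the direction `v` of a complex vector field `e` along `f : N → M`,
computed in the charts at `a` and `f a`. It has an intrinsic meaning when `e a = 0`. -/
noncomputable def derivAlong (f : N → M) (e : ∀ b : N, CT E (f b)) (a : N)
    (v : TangentSpace 𝓘(ℝ, F) a) : CT E (f a) :=
  (1 : ℂ) ⊗ₜ[ℝ] realDerivAlong f (fun b => reC _ (e b)) a v +
    Complex.I ⊗ₜ[ℝ] realDerivAlong f (fun b => imC _ (e b)) a v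

/-- The failure at `b` of the complex vector fields `Z` on `N` and `W` on `M` to be
`f`-related. -/
noncomputable def cRelDefect (f : N → M) (Z : ∀ b : N, CT F b) (W : ∀ x : M, CT E x) (b : N) :
    CT E (f b) :=
  (mfderiv 𝓘(ℝ, F) 𝓘(ℝ, E) f b).toLinearMap.baseChange ℂ (Z b) - W (f b)

theorem reC_cRelDefect (f : N → M) (Z : ∀ b : N, CT F b) (W : ∀ x : M, CT E x) :
    (fun b => reC _ (cRelDefect f Z W b)) =
      relDefect f (fun b => reC _ (Z b)) (fun x => reC _ (W x)) := by
  ext b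
  rw [cRelDefect, map_sub, reC_baseChange]
  rfl

theorem imC_cRelDefect (f : N → M) (Z : ∀ b : N, CT F b) (W : ∀ x : M, CT E x) :
    (fun b => imC _ (cRelDefect f Z W b)) =
      relDefect f (fun b => imC _ (Z b)) (fun x => imC _ (W x)) := by
  ext b
  rw [cRelDefect, map_sub, imC_baseChange]
  rfl

/-- The real and imaginary parts of a complex vector field are continuously differentiable at the
given point. -/
def CFieldC1At [IsManifold 𝓘(ℝ, E) 1 M] (Z : ∀ x : M, CT E x) (p : M) : Prop :=
  FieldC1At (fun x => reC _ (Z x)) p ∧ FieldC1At (fun x => imC _ (Z x)) p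

/-- The complex bilinear version of `mfderiv_mlieBracket_sub_mlieBracket`. -/
theorem baseChange_cBracket_sub_cBracket
    [IsManifold 𝓘(ℝ, F) 2 N] [IsManifold 𝓘(ℝ, E) 2 M] [CompleteSpace F] [CompleteSpace E]
    {f : N → M} {a : N}
    (hf : ContMDiff 𝓘(ℝ, F) 𝓘(ℝ, E) 2 f) {Z₁ Z₂ : ∀ b : N, CT F b}
    {W₁ W₂ : ∀ x : M, CT E x} (hZ₁ : CFieldC1At Z₁ a) (hZ₂ : CFieldC1At Z₂ a)
    (hW₁ : CFieldC1At W₁ (f a)) (hW₂ : CFieldC1At W₂ (f a))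
    (h₁ : (mfderiv 𝓘(ℝ, F) 𝓘(ℝ, E) f a).toLinearMap.baseChange ℂ (Z₁ a) = W₁ (f a))
    (h₂ : (mfderiv 𝓘(ℝ, F) 𝓘(ℝ, E) f a).toLinearMap.baseChange ℂ (Z₂ a) = W₂ (f a)) :
    (mfderiv 𝓘(ℝ, F) 𝓘(ℝ, E) f a).toLinearMap.baseChange ℂ (cBracket Z₁ Z₂ a) -
        cBracket W₁ W₂ (f a) =
      (derivAlong f (cRelDefect f Z₂ W₂) a (reC _ (Z₁ a)) +
          Complex.I • derivAlong f (cRelDefect f Z₂ W₂) a (imC _ (Z₁ a))) -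
        (derivAlong f (cRelDefect f Z₁ W₁) a (reC _ (Z₂ a)) +
          Complex.I • derivAlong f (cRelDefect f Z₁ W₁) a (imC _ (Z₂ a))) := by
  have r₁ := congrArg (reC _) h₁
  have i₁ := congrArg (imC _) h₁
  have r₂ := congrArg (reC _) h₂
  have i₂ := congrArg (imC _) h₂
  rw [reC_baseChange] at r₁ r₂
  rw [imC_baseChange] at i₁ i₂
  have key := fun {X₁ X₂ : ∀ b : N, TangentSpace 𝓘(ℝ, F) b}
    {Y₁ Y₂ : ∀ x : M, TangentSpace 𝓘(ℝ, E) x} (hX₁ : FieldC1At X₁ a) (hX₂ : FieldC1At X₂ a)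
    (hY₁ : FieldC1At Y₁ (f a)) (hY₂ : FieldC1At Y₂ (f a))
    (h₁ : mfderiv 𝓘(ℝ, F) 𝓘(ℝ, E) f a (X₁ a) = Y₁ (f a))
    (h₂ : mfderiv 𝓘(ℝ, F) 𝓘(ℝ, E) f a (X₂ a) = Y₂ (f a)) =>
    show mfderiv 𝓘(ℝ, F) 𝓘(ℝ, E) f a (mlieBracket 𝓘(ℝ, F) X₁ X₂ a) =
        realDerivAlong f (relDefect f X₂ Y₂) a (X₁ a) -
          realDerivAlong f (relDefect f X₁ Y₁) a (X₂ a) + mlieBracket 𝓘(ℝ, E) Y₁ Y₂ (f a) from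
    sub_eq_iff_eq_add.1
      (mfderiv_mlieBracket_sub_mlieBracket hf hX₁ hX₂ hY₁ hY₂ h₁ h₂)
  have k₁ := key hZ₁.1 hZ₂.1 hW₁.1 hW₂.1 r₁ r₂
  have k₂ := key hZ₁.2 hZ₂.2 hW₁.2 hW₂.2 i₁ i₂
  have k₃ := key hZ₁.1 hZ₂.2 hW₁.1 hW₂.2 r₁ i₂
  have k₄ := key hZ₁.2 hZ₂.1 hW₁.2 hW₂.1 i₁ r₂
  simp only [derivAlong, reC_cRelDefect, imC_cRelDefect]
  simp only [cBracket, map_add, LinearMap.baseChange_tmul, map_sub, TensorProduct.tmul_add,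
    TensorProduct.tmul_sub, smul_add, TensorProduct.smul_tmul', smul_eq_mul, mul_one,
    Complex.I_mul_I, TensorProduct.neg_tmul, ContinuousLinearMap.coe_coe]
  rw [k₁, k₂, k₃, k₄]
  simp only [TensorProduct.tmul_add, TensorProduct.tmul_sub]
  abel

open Filter in
/-- The derivative of a section of `T^{1,0}M` along a map is tangent to `T^{1,0}M` at the zeros of
the section. -/
theorem CRStructure.derivAlong_mem_T10 [FiniteDimensional ℝ E] [IsManifold 𝓘(ℝ, E) ∞ M] {n : ℕ}
    (C : CRStructure E M n) {f : N → M} {a : N} (hf : ContinuousAt f a)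
    {e : ∀ b : N, CT E (f b)} (he : ∀ᶠ b in 𝓝 a, e b ∈ C.T10 (f b)) (hea : e a = 0)
    (hre : DifferentiableAt ℝ (coordAlong f (fun b => reC _ (e b)) a) (extChartAt 𝓘(ℝ, F) a a))
    (him : DifferentiableAt ℝ (coordAlong f (fun b => imC _ (e b)) a) (extChartAt 𝓘(ℝ, F) a a))
    (v : TangentSpace 𝓘(ℝ, F) a) : derivAlong f e a v ∈ C.T10 (f a) := by
  obtain ⟨U, hU, haU, L, hL, hspan⟩ := C.exists_frame (f a)
  set φ := extChartAt 𝓘(ℝ, E) (f a) with hφ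
  set ψ := extChartAt 𝓘(ℝ, F) a with hψ
  -- work along the curve `c` through `a` which is a line in the direction `v` in the chart, and
  -- read the vectors at `f (c t)` in the chart at `f a` by means of `D`
  let D : ∀ q : M, CT E q →ₗ[ℂ] ℂ ⊗[ℝ] E := fun q =>
    (mfderiv 𝓘(ℝ, E) 𝓘(ℝ, E) φ q : TangentSpace 𝓘(ℝ, E) q →L[ℝ] E).toLinearMap.baseChange ℂ
  let w : F := v
  let c : ℝ → N := fun t => ψ.symm (ψ a + t • w)
  have hline : Tendsto (fun t : ℝ => ψ a + t • w) (𝓝[≠] 0) (𝓝 (ψ a)) := by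
    have : Continuous (fun t : ℝ => ψ a + t • w) := by fun_prop
    have := this.tendsto 0
    rw [zero_smul, add_zero] at this
    exact this.mono_left nhdsWithin_le_nhds
  have hc : Tendsto c (𝓝[≠] 0) (𝓝 a) := by
    have h := (continuousAt_extChartAt_symm (I := 𝓘(ℝ, F)) a).tendsto
    rw [extChartAt_to_inv] at h
    exact h.comp hline
  have hfc : Tendsto (fun t => f (c t)) (𝓝[≠] 0) (𝓝 (f a)) := hf.tendsto.comp hc
  have hφc : Tendsto (fun t => φ (f (c t))) (𝓝[≠] 0) (𝓝 (φ (f a))) :=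
    (continuousAt_extChartAt (f a)).tendsto.comp hfc
  have hsrc : ∀ᶠ t in 𝓝[≠] (0 : ℝ), f (c t) ∈ φ.source :=
    hfc.eventually (extChartAt_source_mem_nhds (f a))
  have hfield : ∀ {Y : ∀ x : M, TangentSpace 𝓘(ℝ, E) x}, FieldC1At Y (f a) →
      Tendsto (fun t => (mfderiv 𝓘(ℝ, E) 𝓘(ℝ, E) φ (f (c t)) (Y (f (c t))) : E)) (𝓝[≠] 0)
        (𝓝 (Y (f a))) := by
    intro Y hY
    have h := (contDiffAt_coordField hY).continuousAt.tendsto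
    rw [coordField_extChartAt_self] at h
    refine (h.comp hφc).congr' ?_
    filter_upwards [hsrc] with t ht
    have := coordField_apply (φ.map_source ht) Y
    rw [φ.left_inv ht] at this
    exact this
  have hLC : ∀ j, CFieldC1At (L j) (f a) := fun j =>
    ⟨((hL j).1.contMDiffAt (hU.mem_nhds haU)).of_le (by simp),
      ((hL j).2.contMDiffAt (hU.mem_nhds haU)).of_le (by simp)⟩
  have hind : LinearIndependent ℂ (fun j => L j (f a)) := by
    rw [linearIndependent_iff_card_eq_finrank_span, Set.finrank, ← hspan _ haU, C.finrank_T10]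
    simp
  have hderiv : ∀ {g : F → E}, DifferentiableAt ℝ g (ψ a) → g (ψ a) = 0 →
      Tendsto (fun t : ℝ => t⁻¹ • g (ψ a + t • w)) (𝓝[≠] 0) (𝓝 (fderiv ℝ g (ψ a) w)) := by
    intro g hg h0
    have h := hg.hasFDerivAt.hasLineDerivAt w
    have h := hasDerivAt_iff_tendsto_slope_zero.1 h
    simpa [h0] using h
  have hzero : ∀ (b : N), b = a → e b = 0 := by rintro _ rfl; exact hea
  have hzero' : e (ψ.symm (ψ a)) = 0 := hzero _ (extChartAt_to_inv a)
  have hre0 : coordAlong f (fun b => reC _ (e b)) a (ψ a) = 0 := by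
    simp only [coordAlong]
    rw [hzero', map_zero, map_zero]
    rfl
  have him0 : coordAlong f (fun b => imC _ (e b)) a (ψ a) = 0 := by
    simp only [coordAlong]
    rw [hzero', map_zero, map_zero]
    rfl
  rw [hspan _ haU]
  refine mem_span_of_tendsto (V := E) (l := 𝓝[≠] (0 : ℝ)) (L := fun j t => D _ (L j (f (c t))))
    (L₀ := fun j => L j (f a)) (e := fun t => ((t⁻¹ : ℝ) : ℂ) • D _ (e (c t)))
    hind (fun j => ?_) (fun j => ?_) ?_ ?_ ?_
  · refine (hfield (hLC j).1).congr fun t => ?_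
    exact (reC_baseChange _ _).symm
  · refine (hfield (hLC j).2).congr fun t => ?_
    exact (imC_baseChange _ _).symm
  · refine (hderiv hre hre0).congr fun t => ?_
    rw [reC_smul, Complex.ofReal_re, Complex.ofReal_im, zero_smul, sub_zero]
    congr 1
    exact (reC_baseChange _ _).symm
  · refine (hderiv him him0).congr fun t => ?_
    rw [imC_smul, Complex.ofReal_re, Complex.ofReal_im, zero_smul, add_zero]
    congr 1
    exact (imC_baseChange _ _).symm
  · filter_upwards [hfc.eventually (hU.mem_nhds haU), hc.eventually he] with t ht ht'
    rw [hspan _ ht] at ht'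
    have h := Submodule.mem_map_of_mem (f := D (f (c t))) ht'
    rw [Submodule.map_span, ← Set.range_comp] at h
    exact Submodule.smul_mem _ _ h

theorem coordAlong_neg (f : N → M) (e : ∀ b : N, TangentSpace 𝓘(ℝ, E) (f b)) (a : N) :
    coordAlong (F := F) f (fun b => -e b) a = -coordAlong f e a := by
  ext y
  exact map_neg _ _

theorem realDerivAlong_neg (f : N → M) (e : ∀ b : N, TangentSpace 𝓘(ℝ, E) (f b)) (a : N)
    (v : TangentSpace 𝓘(ℝ, F) a) :
    realDerivAlong f (fun b => -e b) a v = -realDerivAlong f e a v := by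
  simp only [realDerivAlong, coordAlong_neg, fderiv_neg]
  rfl

theorem conjC_derivAlong (f : N → M) (e : ∀ b : N, CT E (f b)) (a : N)
    (v : TangentSpace 𝓘(ℝ, F) a) :
    conjC _ (derivAlong f e a v) = derivAlong f (fun b => conjC _ (e b)) a v := by
  simp only [derivAlong, reC_conjC, imC_conjC, realDerivAlong_neg, map_add, conjC_tmul, map_one,
    Complex.conj_I, TensorProduct.neg_tmul, TensorProduct.tmul_neg]

theorem CRStructure.derivAlong_mem_T01 [FiniteDimensional ℝ E] [IsManifold 𝓘(ℝ, E) ∞ M] {n : ℕ}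
    (C : CRStructure E M n) {f : N → M} {a : N} (hf : ContinuousAt f a)
    {e : ∀ b : N, CT E (f b)} (he : ∀ᶠ b in 𝓝 a, e b ∈ C.T01 (f b)) (hea : e a = 0)
    (hre : DifferentiableAt ℝ (coordAlong f (fun b => reC _ (e b)) a) (extChartAt 𝓘(ℝ, F) a a))
    (him : DifferentiableAt ℝ (coordAlong f (fun b => imC _ (e b)) a) (extChartAt 𝓘(ℝ, F) a a))
    (v : TangentSpace 𝓘(ℝ, F) a) : derivAlong f e a v ∈ C.T01 (f a) := by
  rw [mem_T01_iff, conjC_derivAlong]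
  refine C.derivAlong_mem_T10 hf ?_ ?_ ?_ ?_ v
  · filter_upwards [he] with b hb
    exact C.mem_T01_iff.1 hb
  · rw [hea, map_zero]
  · simpa only [reC_conjC] using hre
  · simp only [imC_conjC, coordAlong_neg]
    exact him.neg

end ComplexAlong

/-! ### Left invariant complex vector fields -/

section Invariant

variable {F : Type*} [NormedAddCommGroup F] [NormedSpace ℝ F]
  {G : Type*} [TopologicalSpace G] [ChartedSpace F G] [Group G]

/-- The left invariant complex vector field on `G` with value `Z` at the identity. -/
noncomputable def cInvariantField (Z : CLie F G) (b : G) : CT F b :=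
  (1 : ℂ) ⊗ₜ[ℝ] mulInvariantVectorField (reC _ Z) b +
    Complex.I ⊗ₜ[ℝ] mulInvariantVectorField (imC _ Z) b

theorem reC_cInvariantField (Z : CLie F G) (b : G) :
    reC _ (cInvariantField Z b) = mulInvariantVectorField (reC _ Z) b := reC_mk _ _

theorem imC_cInvariantField (Z : CLie F G) (b : G) :
    imC _ (cInvariantField Z b) = mulInvariantVectorField (imC _ Z) b := imC_mk _ _

theorem mulInvariantVectorField_one (v : GroupLieAlgebra 𝓘(ℝ, F) G) :
    mulInvariantVectorField v (1 : G) = v := by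
  have h : (fun x : G => 1 * x) = id := by ext x; simp
  have h' : mfderiv 𝓘(ℝ, F) 𝓘(ℝ, F) (fun x : G => 1 * x) 1 = mfderiv 𝓘(ℝ, F) 𝓘(ℝ, F) id 1 := by
    rw [h]
  rw [mfderiv_id] at h'
  exact DFunLike.congr_fun h' v

theorem cInvariantField_one (Z : CLie F G) : cInvariantField Z 1 = Z := by
  rw [cInvariantField, mulInvariantVectorField_one, mulInvariantVectorField_one]
  exact one_tmul_reC_add_I_tmul_imC Z

variable [LieGroup 𝓘(ℝ, F) ∞ G]

theorem cFieldC1At_cInvariantField [IsManifold 𝓘(ℝ, F) 1 G] (Z : CLie F G) (b : G) :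
    CFieldC1At (cInvariantField Z) b := by
  have h : ∀ v : GroupLieAlgebra 𝓘(ℝ, F) G, FieldC1At (mulInvariantVectorField v) b := fun v =>
    (contMDiffAt_mulInvariantVectorField v).of_le
      (le_trans (by norm_num) (le_minSmoothness (𝕜 := ℝ) (n := 2)))
  simp only [CFieldC1At, reC_cInvariantField, imC_cInvariantField]
  exact ⟨h _, h _⟩

theorem cBracket_cInvariantField [FiniteDimensional ℝ F] (Z₁ Z₂ : CLie F G) :
    cBracket (cInvariantField Z₁) (cInvariantField Z₂) 1 = ⁅Z₁, Z₂⁆ := by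
  conv_rhs => rw [← one_tmul_reC_add_I_tmul_imC Z₁, ← one_tmul_reC_add_I_tmul_imC Z₂]
  simp only [cBracket, reC_cInvariantField, imC_cInvariantField, ← GroupLieAlgebra.bracket_def,
    add_lie, lie_add, LieAlgebra.ExtendScalars.bracket_tmul, mul_one, one_mul, Complex.I_mul_I,
    TensorProduct.tmul_add, TensorProduct.tmul_sub, TensorProduct.neg_tmul]
  abel

end Invariant

/-! ### Homogeneous CR manifolds and the CR algebra -/

section Homogeneous

variable {F : Type*} [NormedAddCommGroup F] [NormedSpace ℝ F]
  {G : Type*} [TopologicalSpace G] [ChartedSpace F G] [Group G]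
  {E : Type*} [NormedAddCommGroup E] [NormedSpace ℝ E]
  {M : Type*} [TopologicalSpace M] [ChartedSpace E M] [MulAction G M]

theorem conjC_dpi (p : M) (Z : CLie F G) :
    conjC _ (dpi (E := E) F G p Z) = dpi F G p (conjC _ Z) :=
  (baseChange_conjC (orbitDeriv (E := E) F G p) Z).symm

theorem dpi_surjective {p : M} (h : Function.Surjective (orbitDeriv (E := E) F G p)) :
    Function.Surjective (dpi (E := E) F G p) :=
  LinearMap.lTensor_surjective ℂ h

theorem baseChange_mfderiv_orbitMap_cInvariantField [LieGroup 𝓘(ℝ, F) ∞ G]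
    (h : ContMDiff (𝓘(ℝ, F).prod 𝓘(ℝ, E)) 𝓘(ℝ, E) ∞ (fun p : G × M => p.1 • p.2)) (p : M)
    (Z : CLie F G) (b : G) :
    (mfderiv 𝓘(ℝ, F) 𝓘(ℝ, E) (fun a : G => a • p) b).toLinearMap.baseChange ℂ
        (cInvariantField Z b) =
      (mfderiv 𝓘(ℝ, E) 𝓘(ℝ, E) (fun y : M => b • y) p).toLinearMap.baseChange ℂ (dpi F G p Z) := by
  rw [← one_tmul_reC_add_I_tmul_imC (dpi F G p Z), dpi, reC_baseChange, imC_baseChange,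
    cInvariantField, map_add, map_add]
  simp only [LinearMap.baseChange_tmul, ContinuousLinearMap.coe_coe]
  rw [mfderiv_orbitMap_mulInvariantVectorField h, mfderiv_orbitMap_mulInvariantVectorField h]

variable [IsManifold 𝓘(ℝ, E) ∞ M] {n : ℕ} {C : CRStructure E M n}

theorem IsHomogeneousCR.baseChange_mem_T10 (hC : IsHomogeneousCR F G C) (a : G) {x : M}
    {Z : CT E x} (hZ : Z ∈ C.T10 x) :
    (mfderiv 𝓘(ℝ, E) 𝓘(ℝ, E) (fun y : M => a • y) x).toLinearMap.baseChange ℂ Z ∈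
      C.T10 (a • x) :=
  hC.map_T10 a x ▸ Submodule.mem_map_of_mem hZ

theorem IsHomogeneousCR.baseChange_mem_T01 (hC : IsHomogeneousCR F G C) (a : G) {x : M}
    {Z : CT E x} (hZ : Z ∈ C.T01 x) :
    (mfderiv 𝓘(ℝ, E) 𝓘(ℝ, E) (fun y : M => a • y) x).toLinearMap.baseChange ℂ Z ∈
      C.T01 (a • x) := by
  rw [CRStructure.mem_T01_iff, ← baseChange_conjC]
  exact hC.baseChange_mem_T10 a (C.mem_T01_iff.1 hZ)

theorem CFieldC1At.of_smoothFieldOn {U : Set M} (hU : IsOpen U) {Z : ∀ x : M, CT E x}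
    (hZ : SmoothFieldOn U Z) {x : M} (hx : x ∈ U) : CFieldC1At Z x :=
  ⟨(hZ.1.contMDiffAt (hU.mem_nhds hx)).of_le (by simp),
    (hZ.2.contMDiffAt (hU.mem_nhds hx)).of_le (by simp)⟩

theorem CFieldC1At.conjC {Z : ∀ x : M, CT E x} {x : M} (hZ : CFieldC1At Z x) :
    CFieldC1At (fun y => CRGeom.conjC _ (Z y)) x := by
  simp only [CFieldC1At, reC_conjC, imC_conjC]
  exact ⟨hZ.1, ContMDiffAt.neg_section hZ.2⟩

theorem differentiableAt_coordAlong_cRelDefect [FiniteDimensional ℝ F] [FiniteDimensional ℝ E]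
    {N : Type*} [TopologicalSpace N] [ChartedSpace F N] [IsManifold 𝓘(ℝ, F) 2 N]
    {f : N → M} {a : N} (hf : ContMDiff 𝓘(ℝ, F) 𝓘(ℝ, E) 2 f) {Z : ∀ b : N, CT F b}
    {W : ∀ x : M, CT E x} (hZ : CFieldC1At Z a) (hW : CFieldC1At W (f a)) :
    DifferentiableAt ℝ (coordAlong f (fun b => reC _ (cRelDefect f Z W b)) a)
        (extChartAt 𝓘(ℝ, F) a a) ∧
      DifferentiableAt ℝ (coordAlong f (fun b => imC _ (cRelDefect f Z W b)) a)
        (extChartAt 𝓘(ℝ, F) a a) := by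
  rw [reC_cRelDefect, imC_cRelDefect]
  exact ⟨differentiableAt_coordAlong_relDefect hf hZ.1 hW.1,
    differentiableAt_coordAlong_relDefect hf hZ.2 hW.2⟩

/-- The bracket of a section of `T^{0,1}M` and a section of `T^{1,0}M` agrees modulo `ℂHM` with the
image of the bracket in `𝔤` of any lifts of their values at `p`. -/
theorem IsHomogeneousCR.dpi_lie_sub_cBracket_mem [FiniteDimensional ℝ F] [FiniteDimensional ℝ E]
    [LieGroup 𝓘(ℝ, F) ∞ G] (hC : IsHomogeneousCR F G C) {p : M}
    {Z₁ Z₂ : CLie F G} {W₁ W₂ : ∀ x : M, CT E x} (hW₁ : CFieldC1At W₁ p) (hW₂ : CFieldC1At W₂ p)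
    (hT₁ : ∀ᶠ x in 𝓝 p, W₁ x ∈ C.T01 x) (hT₂ : ∀ᶠ x in 𝓝 p, W₂ x ∈ C.T10 x)
    (h₁ : dpi F G p Z₁ = W₁ p) (h₂ : dpi F G p Z₂ = W₂ p) :
    dpi F G p ⁅Z₁, Z₂⁆ - cBracket W₁ W₂ p ∈ C.CH p := by
  have hf := contMDiff_orbitMap hC.smooth p
  set f : G → M := fun a => a • p with hfdef
  have hf2 : ContMDiff 𝓘(ℝ, F) 𝓘(ℝ, E) 2 f := hf.of_le ENat.LEInfty.out
  have hf1 : f 1 = p := one_smul G p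
  have hlim : Filter.Tendsto f (𝓝 1) (𝓝 p) := by
    have := hf.continuous.tendsto 1
    rwa [hf1] at this
  have hW₁' : CFieldC1At W₁ (f 1) := by rwa [hf1]
  have hW₂' : CFieldC1At W₂ (f 1) := by rwa [hf1]
  have hrel : ∀ (Z : CLie F G) (W : ∀ x : M, CT E x), dpi F G p Z = W p →
      (mfderiv 𝓘(ℝ, F) 𝓘(ℝ, E) f 1).toLinearMap.baseChange ℂ (cInvariantField Z 1) =
        W (f 1) := by
    intro Z W h
    have h3 : ∀ q : M, q = p → (W q : ℂ ⊗[ℝ] E) = W p := by rintro _ rfl; rfl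
    rw [cInvariantField_one]
    exact h.trans (h3 _ hf1).symm
  have hdef : ∀ (Z : CLie F G) (W : ∀ x : M, CT E x), dpi F G p Z = W p →
      cRelDefect f (cInvariantField Z) W 1 = 0 := fun Z W h => sub_eq_zero.2 (hrel Z W h)
  have e₁ : ∀ᶠ b in 𝓝 (1 : G), cRelDefect f (cInvariantField Z₁) W₁ b ∈ C.T01 (f b) := by
    filter_upwards [hlim.eventually hT₁] with b hb
    refine Submodule.sub_mem _ ?_ hb
    rw [baseChange_mfderiv_orbitMap_cInvariantField hC.smooth]
    exact hC.baseChange_mem_T01 b (h₁ ▸ hT₁.self_of_nhds)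
  have e₂ : ∀ᶠ b in 𝓝 (1 : G), cRelDefect f (cInvariantField Z₂) W₂ b ∈ C.T10 (f b) := by
    filter_upwards [hlim.eventually hT₂] with b hb
    refine Submodule.sub_mem _ ?_ hb
    rw [baseChange_mfderiv_orbitMap_cInvariantField hC.smooth]
    exact hC.baseChange_mem_T10 b (h₂ ▸ hT₂.self_of_nhds)
  have i₁ := cFieldC1At_cInvariantField Z₁ (1 : G)
  have i₂ := cFieldC1At_cInvariantField Z₂ (1 : G)
  have key := baseChange_cBracket_sub_cBracket hf2 i₁ i₂ hW₁' hW₂' (hrel _ _ h₁) (hrel _ _ h₂)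
  have d₁ := differentiableAt_coordAlong_cRelDefect hf2 i₁ hW₁'
  have d₂ := differentiableAt_coordAlong_cRelDefect hf2 i₂ hW₂'
  have m₁ := C.derivAlong_mem_T01 hf.continuous.continuousAt e₁ (hdef _ _ h₁) d₁.1 d₁.2
  have m₂ := C.derivAlong_mem_T10 hf.continuous.continuousAt e₂ (hdef _ _ h₂) d₂.1 d₂.2
  have hmem : (mfderiv 𝓘(ℝ, F) 𝓘(ℝ, E) f 1).toLinearMap.baseChange ℂ
      (cBracket (cInvariantField Z₁) (cInvariantField Z₂) 1) - cBracket W₁ W₂ (f 1) ∈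
        C.CH (f 1) := by
    rw [key]
    refine Submodule.sub_mem _ (Submodule.mem_sup_left ?_) (Submodule.mem_sup_right ?_)
    · exact Submodule.add_mem _ (m₂ _) (Submodule.smul_mem _ _ (m₂ _))
    · exact Submodule.add_mem _ (m₁ _) (Submodule.smul_mem _ _ (m₁ _))
  rw [cBracket_cInvariantField] at hmem
  -- `f 1 = 1 • p` is only propositionally equal to `p`; all tangent spaces are copies of `E`
  have h3 : ∀ q : M, q = p → ∀ x : ℂ ⊗[ℝ] E,
      (show CT E q from x) - cBracket W₁ W₂ q ∈ C.CH q →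
        (show CT E p from x) - cBracket W₁ W₂ p ∈ C.CH p := by
    rintro _ rfl x h; exact h
  exact h3 _ hf1 _ hmem

theorem CRStructure.qbar_eq_comap (C : CRStructure E M n) (p : M) :
    C.qbar F G p = (C.T10 p).comap (dpi F G p) := by
  ext Z
  have hq : ∀ Z : CLie F G, Z ∈ C.q F G p ↔ dpi F G p (conjC _ Z) ∈ C.T10 p := fun Z => by
    rw [← conjC_dpi, ← C.mem_T01_iff]
    rfl
  constructor
  · rintro ⟨Z', hZ', rfl⟩
    exact (hq Z').1 hZ'
  · intro hZ
    refine ⟨conjC _ Z, (hq _).2 ?_, conjC_conjC Z⟩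
    rwa [conjC_conjC]

theorem CRStructure.map_dpi_qbar (C : CRStructure E M n) {p : M}
    (h : Function.Surjective (dpi (E := E) F G p)) :
    (C.qbar F G p).map (dpi F G p) = C.T10 p := by
  rw [C.qbar_eq_comap, Submodule.map_comap_eq_of_surjective h]

theorem CRStructure.map_dpi_q_sup_qbar (C : CRStructure E M n) {p : M}
    (h : Function.Surjective (dpi (E := E) F G p)) :
    (C.q F G p ⊔ C.qbar F G p).map (dpi F G p) = C.CH p := by
  rw [Submodule.map_sup, C.map_dpi_qbar h, CRStructure.q, Submodule.map_comap_eq_of_surjective h,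
    sup_comm]
  rfl

theorem CRStructure.comap_dpi_CH (C : CRStructure E M n) {p : M}
    (h : Function.Surjective (dpi (E := E) F G p)) :
    (C.CH p).comap (dpi F G p) = C.q F G p ⊔ C.qbar F G p := by
  rw [← C.map_dpi_q_sup_qbar h, Submodule.comap_map_eq, sup_eq_left]
  exact le_sup_of_le_left fun Z hZ => by
    change dpi F G p Z ∈ C.T01 p
    rw [LinearMap.mem_ker.1 hZ]
    exact zero_mem _

/-- The isomorphism `ϖ : 𝔤 / (𝔮 + conj 𝔮) ≃ ℂT_pM / ℂH_pM` induced by `dπ`. -/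
noncomputable def CRStructure.quotEquiv (C : CRStructure E M n) {p : M}
    (h : Function.Surjective (dpi (E := E) F G p)) :
    (CLie F G ⧸ (C.q F G p ⊔ C.qbar F G p)) ≃ₗ[ℂ] (CT E p ⧸ C.CH p) :=
  (Submodule.quotEquivOfEq _ _ (by
    rw [← C.comap_dpi_CH h, LinearMap.ker_comp, Submodule.ker_mkQ])).trans
    (LinearMap.quotKerEquivOfSurjective ((C.CH p).mkQ ∘ₗ dpi F G p)
      ((C.CH p).mkQ_surjective.comp h))

theorem CRStructure.dpiConj_surjective (C : CRStructure E M n) {p : M}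
    (h : Function.Surjective (dpi (E := E) F G p)) :
    Function.Surjective (C.dpiConj F G p) := by
  rintro ⟨z, hz⟩
  rw [← C.map_dpi_qbar h] at hz
  obtain ⟨_, ⟨Z, hZ, rfl⟩, hz⟩ := hz
  exact ⟨⟨Z, hZ⟩, Subtype.ext hz⟩

/-- The Levi form computed with arbitrary extensions of the vectors `dπ (conj Z₁)` and
`dπ (conj Z₂)`. The right hand side does not involve the extensions. -/
theorem IsHomogeneousCR.leviValue_eq [FiniteDimensional ℝ F] [FiniteDimensional ℝ E]
    [LieGroup 𝓘(ℝ, F) ∞ G] (hC : IsHomogeneousCR F G C) {p : M} (Z₁ Z₂ : C.q F G p)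
    {Z W : ∀ x : M, CT E x} (hZ : C.IsExtension p (C.dpiConj F G p Z₁) Z)
    (hW : C.IsExtension p (C.dpiConj F G p Z₂) W) :
    C.leviValue p Z W = (1 / (2 * Complex.I)) • (C.CH p).mkQ
      (dpi F G p ⁅(Z₁ : CLie F G), conjC _ (Z₂ : CLie F G)⁆) := by
  obtain ⟨⟨U, hU, hpU, hZs, hZm⟩, hZp⟩ := hZ
  obtain ⟨⟨U', hU', hpU', hWs, hWm⟩, hWp⟩ := hW
  rw [CRStructure.leviValue]
  congr 1
  refine ((Submodule.Quotient.eq _).2 (hC.dpi_lie_sub_cBracket_mem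
    (CFieldC1At.of_smoothFieldOn hU hZs hpU).conjC (.of_smoothFieldOn hU' hWs hpU') ?_ ?_
    ?_ hWp.symm)).symm
  · filter_upwards [hU.mem_nhds hpU] with x hx
    exact Submodule.mem_map_of_mem (hZm x hx)
  · filter_upwards [hU'.mem_nhds hpU'] with x hx
    exact hWm x hx
  · rw [hZp]
    change _ = conjC _ (dpi F G p (conjC _ (Z₁ : CLie F G)))
    rw [conjC_dpi, conjC_conjC]

end Homogeneous

end CRGeom

theorem proposition7p2
    {F : Type*} [NormedAddCommGroup F] [NormedSpace ℝ F] [FiniteDimensional ℝ F]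
    {G : Type*} [TopologicalSpace G] [T2Space G] [SecondCountableTopology G]
    [ChartedSpace F G] [Group G] [LieGroup 𝓘(ℝ, F) ∞ G]
    {E : Type*} [NormedAddCommGroup E] [NormedSpace ℝ E] [FiniteDimensional ℝ E]
    {M : Type*} [TopologicalSpace M] [T2Space M] [SecondCountableTopology M]
    [ChartedSpace E M] [IsManifold 𝓘(ℝ, E) ∞ M] [MulAction G M]
    {n : ℕ} (C : CRGeom.CRStructure E M n) (hC : CRGeom.IsHomogeneousCR F G C) (p : M) :
    -- the Levi form at `p` does not depend on the extensions used to compute it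
    (∀ (z w : C.T10 p) (Z W : ∀ y : M, CRGeom.CT E y),
      C.IsExtension p z Z → C.IsExtension p w W → C.leviValue p Z W = C.leviForm p z w) ∧
    -- the images of the conjugate of `𝔮` and of its sum with `𝔮`
    (C.qbar F G p).map (CRGeom.dpi F G p) = C.T10 p ∧
    (C.q F G p ⊔ C.qbar F G p).map (CRGeom.dpi F G p) = C.CH p ∧
    -- the isomorphism `ϖ` induced by `dπ`, and the commutative diagram
    ∃ ϖ : (CRGeom.CLie F G ⧸ (C.q F G p ⊔ C.qbar F G p)) ≃ₗ[ℂ] (CRGeom.CT E p ⧸ C.CH p),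
      (∀ Z : CRGeom.CLie F G,
        ϖ ((C.q F G p ⊔ C.qbar F G p).mkQ Z) = (C.CH p).mkQ (CRGeom.dpi F G p Z)) ∧
      ∀ L : C.T10 p → C.T10 p → CRGeom.CT E p ⧸ C.CH p,
        L = C.leviForm p ↔
          ∀ Z₁ Z₂ : C.q F G p,
            L (C.dpiConj F G p Z₁) (C.dpiConj F G p Z₂) =
              (1 / (2 * Complex.I)) • ϖ ((C.q F G p ⊔ C.qbar F G p).mkQ
                ⁅(Z₁ : CRGeom.CLie F G), CRGeom.conjC _ (Z₂ : CRGeom.CLie F G)⁆) := by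
  have hsurj := CRGeom.dpi_surjective (CRGeom.orbitDeriv_surjective hC.smooth hC.transitive p)
  have hlevi : ∀ Z₁ Z₂ : C.q F G p, C.leviForm p (C.dpiConj F G p Z₁) (C.dpiConj F G p Z₂) =
      (1 / (2 * Complex.I)) • (C.CH p).mkQ (CRGeom.dpi F G p
        ⁅(Z₁ : CRGeom.CLie F G), CRGeom.conjC _ (Z₂ : CRGeom.CLie F G)⁆) := fun Z₁ Z₂ =>
    hC.leviValue_eq Z₁ Z₂ (C.exists_isExtension p _).choose_spec
      (C.exists_isExtension p _).choose_spec
  refine ⟨?_, C.map_dpi_qbar hsurj, C.map_dpi_q_sup_qbar hsurj, C.quotEquiv hsurj,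
    fun Z => rfl, fun L => ⟨?_, fun hL => ?_⟩⟩
  · intro z w Z W hZ hW
    obtain ⟨Z₁, rfl⟩ := C.dpiConj_surjective hsurj z
    obtain ⟨Z₂, rfl⟩ := C.dpiConj_surjective hsurj w
    rw [hC.leviValue_eq Z₁ Z₂ hZ hW, hlevi]
  · rintro rfl
    exact hlevi
  · funext z w
    obtain ⟨Z₁, rfl⟩ := C.dpiConj_surjective hsurj z
    obtain ⟨Z₂, rfl⟩ := C.dpiConj_surjective hsurj w
    exact (hL Z₁ Z₂).trans (hlevi Z₁ Z₂).symm
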